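/- Work in $\mathbf F_2[[q]]$. Let $\Delta=\sum_{m\ge 0}q^{(2m+1)^2}$ (the reduction mod $2$ of $\sum_{n\ge1}\tau(n)q^n$), and let $\mathcal F$ be the $\mathbf F_2$-subspace of $\mathbf F_2[[q]]$ spanned by the odd powers $\Delta,\Delta^3,\Delta^5,\dots$. For an odd prime $p$ and $f=\sum_n a_n(f)q^n$, let $T_pf$ be the series whose $n$-th coefficient is $a_{pn}(f)+a_{n/p}(f)$, where $a_{n/p}(f)=0$ if $p\nmid n$. Let $e$ be the linear form on $\mathcal F$ given by $\langle e,f\rangle=a_1(f)$. There is one and only one $\mathbf F_2$-basis $m(a,b)$, $a,b\ge0$, of $\mathcal F$ with the following properties: (i) $m(0,0)=\Delta$; (ii) $\langle e,m(a,b)\rangle=0$ if $a+b>0$; (iii) $T_3\,m(a,b)=m(a-1,b)$ if $a>0$, and $T_3\,m(0,b)=0$; (iv) $T_5\,m(a,b)=m(a,b-1)$ if $b>0$, and $T_5\,m(a,0)=0$. Moreover, for every $f\in\mathcal F$ only finitely many $T_3^iT_5^jf$ are nonzero, so that $u\cdot f=\sum_{i,j\ge 0} u_{ij}T_3^iT_5^jf$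 is defined for every $u=\sum u_{ij}x^iy^j\in\mathbf F_2[[x,y]]$; and the basis $m(a,b)$ is dual to the monomials $x^ay^b$ in the sense that, for all $a,b\ge0$ and all $u\in\mathbf F_2[[x,y]]$, $u\cdot m(a,b)\in\mathcal F$ and $\langle e,u\cdot m(a,b)\rangle=u_{ab}$. -/

import Mathlib

namespace HeckeModTwo

open Classical in
/-- The series `Δ = ∑_{m ≥ 0} q^((2m+1)^2)` in `𝔽₂[[q]]`. -/
noncomputable def Delta : PowerSeries (ZMod 2) :=
  PowerSeries.mk fun n => if ∃ m : ℕ, n = (2 * m + 1) ^ 2 then 1 else 0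

/-- The space `𝓕` spanned over `𝔽₂` by the odd powers of `Δ`. -/
noncomputable def F : Submodule (ZMod 2) (PowerSeries (ZMod 2)) :=
  Submodule.span (ZMod 2) (Set.range fun i : ℕ => Delta ^ (2 * i + 1))

/-- The Hecke operator `T_p` on `q`-expansions mod 2, for an odd prime `p`: the `n`-th
coefficient of `T_p f` is `a_{pn}(f) + a_{n/p}(f)`, where the second term is `0` unless `p ∣ n`.
(The factor `p^(k-1)` of weight `k` is `1` mod 2.) -/
noncomputable def heckeT (p : ℕ) : Module.End (ZMod 2) (PowerSeries (ZMod 2)) where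
  toFun f := PowerSeries.mk fun n =>
    PowerSeries.coeff (p * n) f + if p ∣ n then PowerSeries.coeff (n / p) f else 0
  map_add' f g := by
    ext n
    simp only [PowerSeries.coeff_mk, map_add]
    split_ifs <;> ring
  map_smul' c f := by
    ext n
    simp only [PowerSeries.coeff_mk, PowerSeries.coeff_smul, RingHom.id_apply, smul_eq_mul]
    split_ifs <;> ring

/-- The linear form `e` on `𝓕` given by `⟨e, f⟩ = a_1(f)`. -/
noncomputable def e : Module.Dual (ZMod 2) F :=
  (PowerSeries.coeff (R := ZMod 2) 1).comp F.subtype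

/-- The four properties that characterize the adapted basis. -/
structure IsAdapted (m : Module.Basis (ℕ × ℕ) (ZMod 2) F) : Prop where
  zero_zero : (m (0, 0) : PowerSeries (ZMod 2)) = Delta
  e_eq_zero : ∀ a b : ℕ, 0 < a + b → e (m (a, b)) = 0
  T3_of_pos : ∀ a b : ℕ, 0 < a → heckeT 3 (m (a, b)) = m (a - 1, b)
  T3_zero : ∀ b : ℕ, heckeT 3 (m (0, b)) = 0
  T5_of_pos : ∀ a b : ℕ, 0 < b → heckeT 5 (m (a, b)) = m (a, b - 1)
  T5_zero : ∀ a : ℕ, heckeT 5 (m (a, 0)) = 0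

/-- The monomial `x^i y^j` acts as `T₃^i T₅^j`; exponents are `d = (i, j) = (d 0, d 1)`. -/
noncomputable def monomialAct (d : Fin 2 →₀ ℕ) : Module.End (ZMod 2) (PowerSeries (ZMod 2)) :=
  heckeT 3 ^ d 0 * heckeT 5 ^ d 1

/-- The action of `u = ∑ u_{ij} x^i y^j ∈ 𝔽₂[[x,y]]` on `f`, namely `∑ u_{ij} T₃^i T₅^j f`,
meaningful when only finitely many `T₃^i T₅^j f` are nonzero. -/
noncomputable def seriesAct (u : MvPowerSeries (Fin 2) (ZMod 2)) (f : PowerSeries (ZMod 2)) :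
    PowerSeries (ZMod 2) :=
  ∑ᶠ d : Fin 2 →₀ ℕ, MvPowerSeries.coeff d u • monomialAct d f

end HeckeModTwo

/-! ### Parity of the number of representations by x² + Dy². -/

namespace HeckeModTwo
open PowerSeries Finset

/-! As 𝓕 = Δ·𝔽₂[Δ²], everything moves to polynomials in X = Δ² through `oddEval`: a_1 becomes the
constant coefficient, and T₃, T₅ become commuting operators S, T that lower degrees
(`exists_operators`). Being adapted amounts to being dual to the forms f ↦ (S^i T^j f)(0), so two
things are needed: these forms separate polynomials, and each pair (a, b) has a dual vector.

The operators are controlled by the modular equations relating Δ(q) to Δ(q³) and to Δ(q⁵). These are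
proved by counting solutions of x² + Dy² = n mod 2 (`ncard_norm_prime_mul`), and they turn into
recurrences for T₃ and T₅ on powers of Δ.

For S, give X^m the weight obtained by evaluating the binary expansion of m at √2. By
`coeff_of_recurrence` all terms of S X^m have weight at most that of X^m minus one, and the term of
exactly that weight, if there is one, has coefficient 1. So S is surjective, and an element of ker S
is determined by its coefficients at those m that have no binary digit in even position. In degree
at most 2·4^i this leaves dimension at most 2^i + 1.

For T on ker S, the test vector is X^(2·4^i), that is, Δ^(1 + 4^(i+1)). It lies in ker S because x²
+ y² is anisotropic mod 3, and T^(2^i) sends it to a polynomial with constant coefficient 1, by a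
computation in the Gaussian integers. A nilpotent operator on a space of dimension at most 2^i + 1
with nonzero 2^i-th power is a single Jordan block. Hence ker S ∩ ker T is a line on which the
constant coefficient is nonzero (`ker_inf_ker`). This gives separation; the dual vectors for a = 0
come from the test vectors, and the others from lifting through S (`exists_dual_family`). -/

/-- A finite set with a fixed-point-free involution has even cardinality. -/
theorem ncard_eq_zero_of_involution {α : Type*} {S : Set α} (hS : S.Finite) (g : α → α)
    (hg : ∀ a ∈ S, g a ∈ S) (hgg : ∀ a ∈ S, g (g a) = a) (hne : ∀ a ∈ S, g a ≠ a) :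
    (S.ncard : ZMod 2) = 0 := by
  have h : ∑ a ∈ hS.toFinset, (1 : ZMod 2) = 0 := by
    refine Finset.sum_involution (fun a _ => g a) ?_ ?_ ?_ ?_
    · intro a _; decide
    · intro a ha _; exact hne a (by simpa using ha)
    · intro a ha; simpa using hg a (by simpa using ha)
    · intro a ha; exact hgg a (by simpa using ha)
  rw [Set.ncard_eq_toFinset_card S hS]
  simpa using h

theorem finite_norm_eq {D : ℤ} (hD : 0 < D) (M : ℤ) (P : ℤ × ℤ → Prop) :
    {z : ℤ × ℤ | P z ∧ z.1 ^ 2 + D * z.2 ^ 2 = M}.Finite := by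
  apply ((Set.finite_Icc (-M) M).prod (Set.finite_Icc (-M) M)).subset
  rintro ⟨e, f⟩ ⟨-, h⟩
  simp only at h
  have h1 : f ^ 2 ≤ D * f ^ 2 := by nlinarith [sq_nonneg f]
  simp only [Set.mem_prod, Set.mem_Icc]
  refine ⟨⟨?_, ?_⟩, ?_, ?_⟩ <;>
    nlinarith [sq_nonneg e, sq_nonneg f, sq_nonneg (e - 1), sq_nonneg (e + 1),
      sq_nonneg (f - 1), sq_nonneg (f + 1)]

theorem finite_norm_eq_nat {a b : ℕ} (ha : 0 < a) (hb : 0 < b) (M : ℕ) (P : ℕ × ℕ → Prop) :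
    {z : ℕ × ℕ | P z ∧ a * z.1 ^ 2 + b * z.2 ^ 2 = M}.Finite := by
  apply ((Set.finite_Icc 0 M).prod (Set.finite_Icc 0 M)).subset
  rintro ⟨e, f⟩ ⟨-, h⟩
  simp only at h
  have h1 : e ≤ a * e ^ 2 := by nlinarith [Nat.le_self_pow two_ne_zero e, sq_nonneg e]
  have h2 : f ≤ b * f ^ 2 := by nlinarith [Nat.le_self_pow two_ne_zero f, sq_nonneg f]
  simp only [Set.mem_prod, Set.mem_Icc]
  omega

open Classical in
/-- The number, mod 2, of positive odd integers with square `M`. -/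
theorem ncard_odd_sq (M : ℤ) :
    (({z : ℤ × ℤ | (0 < z.1 ∧ Odd z.1) ∧ z.2 = 0 ∧ z.1 ^ 2 = M}.ncard : ℕ) : ZMod 2) =
      if ∃ x : ℕ, Odd x ∧ M = (x : ℤ) ^ 2 then 1 else 0 := by
  split_ifs with h
  · obtain ⟨x, hx, rfl⟩ := h
    have : {z : ℤ × ℤ | (0 < z.1 ∧ Odd z.1) ∧ z.2 = 0 ∧ z.1 ^ 2 = (x : ℤ) ^ 2} = {((x : ℤ), 0)} := by
      ext ⟨e, f⟩
      simp only [Set.mem_ofPred_eq, Set.mem_singleton_iff, Prod.mk.injEq]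
      constructor
      · rintro ⟨⟨h1, h2⟩, h3, h4⟩
        refine ⟨?_, h3⟩
        rwa [sq_eq_sq₀ h1.le (by positivity)] at h4
      · rintro ⟨rfl, rfl⟩
        exact ⟨⟨by exact_mod_cast hx.pos, by exact_mod_cast hx⟩, rfl, rfl⟩
    rw [this]; simp
  · have : {z : ℤ × ℤ | (0 < z.1 ∧ Odd z.1) ∧ z.2 = 0 ∧ z.1 ^ 2 = M} = ∅ := by
      ext ⟨e, f⟩
      simp only [Set.mem_ofPred_eq, Set.mem_empty_iff_false, iff_false]
      rintro ⟨⟨h1, h2⟩, h3, h4⟩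
      refine h ⟨e.natAbs, by simpa using h2, ?_⟩
      simp [h4]
    rw [this]; simp

open Classical in
/-- Points of odd first coordinate on `x^2 + D y^2 = M`, up to sign, counted mod 2. -/
theorem ncard_half_plane {D : ℤ} (hD : 0 < D) (hD2 : Even D) (M : ℤ) (Q : ℤ → Prop)
    (hQ : ∀ f, Q f → Q (-f)) :
    (({z : ℤ × ℤ | (0 < z.1 - D * z.2 ∧ Odd z.1 ∧ Q z.2) ∧ z.1 ^ 2 + D * z.2 ^ 2 = M}.ncard : ℕ) :
      ZMod 2) = if Q 0 ∧ ∃ x : ℕ, Odd x ∧ M = (x : ℤ) ^ 2 then 1 else 0 := by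
  set S := {z : ℤ × ℤ | (0 < z.1 - D * z.2 ∧ Odd z.1 ∧ Q z.2) ∧ z.1 ^ 2 + D * z.2 ^ 2 = M}
  have hS : S.Finite := finite_norm_eq hD M _
  have h1 : S = {z ∈ S | z.2 = 0} ∪ {z ∈ S | z.2 ≠ 0} := by
    ext z; by_cases h : z.2 = 0 <;> simp [h]
  have h2 : Disjoint {z ∈ S | z.2 = 0} {z ∈ S | z.2 ≠ 0} := by
    rw [Set.disjoint_left]; rintro z ⟨_, h⟩ ⟨_, h'⟩; exact h' h
  rw [h1, Set.ncard_union_eq h2 (hS.subset (Set.sep_subset _ _)) (hS.subset (Set.sep_subset _ _)),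
    Nat.cast_add]
  have h3 : (({z ∈ S | z.2 ≠ 0}.ncard : ℕ) : ZMod 2) = 0 := by
    -- Exactly one of (e, −f) and (−e, f) stays in the half plane e > Df, according to the sign of e
    -- + Df, which is nonzero because e is odd and D even.
    refine ncard_eq_zero_of_involution (hS.subset (Set.sep_subset _ _))
      (fun z => if 0 < z.1 + D * z.2 then (z.1, -z.2) else (-z.1, z.2)) ?_ ?_ ?_
    · rintro ⟨e, f⟩ ⟨⟨⟨h1, h2, h3⟩, h4⟩, h5⟩
      simp only at *
      have h6 : e + D * f ≠ 0 := by
        intro h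
        have : Even (D * f) := hD2.mul_right f
        rw [show e = -(D * f) by linarith] at h2
        exact (Int.not_odd_iff_even.mpr this.neg) h2
      split_ifs with h
      · exact ⟨⟨⟨by simpa using h, h2, hQ _ h3⟩, by simpa using h4⟩, by simpa using h5⟩
      · refine ⟨⟨⟨?_, by simpa using h2, h3⟩, by simpa using h4⟩, h5⟩
        simp only
        omega
    · rintro ⟨e, f⟩ ⟨⟨⟨h1, h2, h3⟩, h4⟩, h5⟩
      simp only at *
      split_ifs with h h' h'
      · simp
      · simp at h'; linarith
      · simp at h'; linarith
      · simp
    · rintro ⟨e, f⟩ ⟨⟨⟨h1, h2, h3⟩, h4⟩, h5⟩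
      simp only at *
      split_ifs with h
      · simp only [ne_eq, Prod.mk.injEq, true_and]; omega
      · simp only [ne_eq, Prod.mk.injEq, and_true]
        rintro h6
        have : e = 0 := by omega
        subst this; simp at h2
  rw [h3, add_zero]
  by_cases hq : Q 0
  · simp only [hq, true_and]
    rw [← ncard_odd_sq]
    congr 2
    ext ⟨e, f⟩
    simp only [S, Set.mem_ofPred_eq]
    constructor
    · rintro ⟨⟨⟨h1, h2, h3⟩, h4⟩, rfl⟩
      simp at *; tauto
    · rintro ⟨⟨h1, h2⟩, rfl, h4⟩
      simp at *; tauto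
  · simp only [hq, false_and, if_false]
    have : {z ∈ S | z.2 = 0} = ∅ := by
      ext ⟨e, f⟩
      simp only [S, Set.mem_ofPred_eq, Set.mem_empty_iff_false, iff_false]
      rintro ⟨⟨⟨h1, h2, h3⟩, h4⟩, rfl⟩
      exact hq h3
    rw [this]; simp

open Classical in
/-- Points in the right half plane on `x^2 + D y^2 = M`, counted mod 2. -/
theorem ncard_right_half_plane {D : ℤ} (hD : 0 < D) (M : ℤ) (Q : ℤ → Prop)
    (hQ : ∀ f, Q f → Q (-f)) :
    (({z : ℤ × ℤ | (0 < z.1 ∧ Odd z.1 ∧ Q z.2) ∧ z.1 ^ 2 + D * z.2 ^ 2 = M}.ncard : ℕ) :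
      ZMod 2) = if Q 0 ∧ ∃ x : ℕ, Odd x ∧ M = (x : ℤ) ^ 2 then 1 else 0 := by
  set S := {z : ℤ × ℤ | (0 < z.1 ∧ Odd z.1 ∧ Q z.2) ∧ z.1 ^ 2 + D * z.2 ^ 2 = M}
  have hS : S.Finite := finite_norm_eq hD M _
  have h1 : S = {z ∈ S | z.2 = 0} ∪ {z ∈ S | z.2 ≠ 0} := by
    ext z; by_cases h : z.2 = 0 <;> simp [h]
  have h2 : Disjoint {z ∈ S | z.2 = 0} {z ∈ S | z.2 ≠ 0} := by
    rw [Set.disjoint_left]; rintro z ⟨_, h⟩ ⟨_, h'⟩; exact h' h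
  rw [h1, Set.ncard_union_eq h2 (hS.subset (Set.sep_subset _ _)) (hS.subset (Set.sep_subset _ _)),
    Nat.cast_add]
  have h3 : (({z ∈ S | z.2 ≠ 0}.ncard : ℕ) : ZMod 2) = 0 := by
    refine ncard_eq_zero_of_involution (hS.subset (Set.sep_subset _ _))
      (fun z => (z.1, -z.2)) ?_ ?_ ?_
    · rintro ⟨e, f⟩ ⟨⟨⟨h1, h2, h3⟩, h4⟩, h5⟩
      exact ⟨⟨⟨h1, h2, hQ _ h3⟩, by simpa using h4⟩, by simpa using h5⟩
    · rintro ⟨e, f⟩ _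
      simp
    · rintro ⟨e, f⟩ ⟨_, h5⟩
      simp only [ne_eq, Prod.mk.injEq, true_and] at *; omega
  rw [h3, add_zero]
  by_cases hq : Q 0
  · simp only [hq, true_and]
    rw [← ncard_odd_sq]
    congr 2
    ext ⟨e, f⟩
    simp only [S, Set.mem_ofPred_eq]
    constructor
    · rintro ⟨⟨⟨h1, h2, h3⟩, h4⟩, rfl⟩
      simp at *; tauto
    · rintro ⟨⟨h1, h2⟩, rfl, h4⟩
      simp at *; tauto
  · simp only [hq, false_and, if_false]
    have : {z ∈ S | z.2 = 0} = ∅ := by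
      ext ⟨e, f⟩
      simp only [S, Set.mem_ofPred_eq, Set.mem_empty_iff_false, iff_false]
      rintro ⟨⟨⟨h1, h2, h3⟩, h4⟩, rfl⟩
      exact hq h3
    rw [this]; simp
end HeckeModTwo

/-! ### Representations of pM by x² + Dy² with p = D + 1. -/

namespace HeckeModTwo
open PowerSeries Finset

/-- Multiplication by `1 + √-D` and its conjugate, for a prime `p = D + 1`: the solutions of
`x^2 + D y^2 = p M` prime to `p`, counted mod 2. -/
theorem ncard_norm_prime_mul {p D : ℕ} (hp : p.Prime) (hpD : p = D + 1) (hD : 0 < D)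
    (hD2 : Even D)
    (Q Q' : ℤ → Prop) (hQ : ∀ f, Q f → Q (-f)) (hQ' : ∀ f, Q' f → Q' (-f))
    (hQQ' : ∀ e f, Odd e → (Q (e + f) ↔ Q' f)) (M : ℕ) :
    open Classical in
    (({z : ℕ × ℕ | (Odd z.1 ∧ 0 < z.2 ∧ Q z.2 ∧ ¬ p ∣ z.1) ∧
      z.1 ^ 2 + D * z.2 ^ 2 = p * M}.ncard : ℕ) : ZMod 2) =
      (if Q' 0 ∧ ∃ x : ℕ, Odd x ∧ M = x ^ 2 then 1 else 0) +
      (if Q 0 ∧ ∃ x : ℕ, Odd x ∧ M = p * x ^ 2 then 1 else 0) := by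
  classical
  have hp' : Prime (p : ℤ) := Nat.prime_iff_prime_int.mp hp
  have hpD' : (p : ℤ) = D + 1 := by exact_mod_cast hpD
  have hp2 : ¬ (p : ℤ) ∣ 2 := by
    intro h
    have h1 : p ∣ 2 := by exact_mod_cast h
    have h2 := Nat.le_of_dvd (by norm_num) h1
    obtain ⟨k, hk⟩ := hD2
    omega
  have hDe : Even (D : ℤ) := by exact_mod_cast hD2
  have hDpos : (0 : ℤ) < D := by exact_mod_cast hD
  have hp0 : (p : ℤ) ≠ 0 := hp'.ne_zero
  set A := {z : ℕ × ℕ | (Odd z.1 ∧ 0 < z.2 ∧ Q z.2 ∧ ¬ p ∣ z.1) ∧ z.1 ^ 2 + D * z.2 ^ 2 = p * M}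
    with hA
  set B := {z : ℤ × ℤ | (0 < z.1 - D * z.2 ∧ Odd z.1 ∧ Q' z.2) ∧ z.1 ^ 2 + D * z.2 ^ 2 = M} with hB
  have hBfin : B.Finite := finite_norm_eq hDpos M _
  -- (e + f√-D)(1 + √-D) = (e − Df) + (e + f)√-D, and 1 + √-D has norm p. Up to signs of the
  -- coordinates, this matches the points of the half plane e > Df with p ∤ e − Df with those of A.
  have hB1 : {z ∈ B | ¬ (p : ℤ) ∣ z.1 - D * z.2}.ncard = A.ncard := by
    refine Set.ncard_congr (fun z _ => ((z.1 - D * z.2).natAbs, (z.1 + z.2).natAbs)) ?_ ?_ ?_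
    · rintro ⟨e, f⟩ ⟨⟨⟨h1, h2, h3⟩, h4⟩, h5⟩
      simp only [hA, Set.mem_ofPred_eq] at *
      have h6 : (e - D * f) ^ 2 + D * (e + f) ^ 2 = p * M := by rw [← h4, hpD']; ring
      refine ⟨⟨?_, ?_, ?_, ?_⟩, ?_⟩
      · rw [Int.natAbs_odd]; exact h2.sub_even (hDe.mul_right f)
      · rw [Int.natAbs_pos]
        intro h
        apply h5
        rw [h] at h6
        exact hp'.dvd_of_dvd_pow (n := 2) ⟨M, by linarith⟩
      · rcases Int.natAbs_eq (e + f) with h | h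
        · rw [← h]; exact (hQQ' e f h2).2 h3
        · have := hQ _ ((hQQ' e f h2).2 h3)
          rwa [h, neg_neg] at this
      · rwa [← Int.natCast_dvd]
      · zify; simpa using h6
    · rintro ⟨e, f⟩ ⟨e', f'⟩ ⟨⟨⟨h1, h2, h3⟩, h4⟩, h5⟩ ⟨⟨⟨h1', h2', h3'⟩, h4'⟩, h5'⟩ h
      simp only [Prod.mk.injEq, Int.natAbs_eq_natAbs_iff] at *
      obtain ⟨ha, hb⟩ := h
      have ha' : e - D * f = e' - D * f' := by omega
      rcases hb with hb | hb
      · have : (p : ℤ) * (f - f') = 0 := by rw [hpD']; linear_combination hb - ha'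
        rcases mul_eq_zero.1 this with h | h
        · exact absurd h hp0
        · have hf : f = f' := by linarith
          subst hf; exact ⟨by linarith, rfl⟩
      -- Second coordinates of opposite sign would force p ∣ 2(e' − Df').
      · exfalso
        have : (p : ℤ) ∣ 2 * (e' - D * f') := by
          refine ⟨-(f + f'), ?_⟩
          rw [hpD']; linear_combination (-1 : ℤ) * ha' + hb
        rcases hp'.dvd_or_dvd this with h | h
        · exact hp2 h
        · exact h5' h
    · rintro ⟨c, d⟩ ⟨⟨h1, h2, h3, h4⟩, h5⟩
      simp only at *
      have h5' : (c : ℤ) ^ 2 + D * d ^ 2 = p * M := by exact_mod_cast h5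
      -- Since D ≡ −1 mod p, c² ≡ d². The sign of d is then chosen to make the element divisible by
      -- 1 + √-D.
      have h6 : (p : ℤ) ∣ ((d : ℤ) - c) * (d + c) :=
        ⟨(d : ℤ) ^ 2 - M, by linear_combination (d : ℤ) ^ 2 * (-hpD') - h5'⟩
      have hcp : ¬ (p : ℤ) ∣ c := by rwa [Int.natCast_dvd_natCast]
      have hc0 : (0 : ℤ) < c := by exact_mod_cast h1.pos
      have key : ∀ d' : ℤ, d'.natAbs = d → (p : ℤ) ∣ d' - c → Q d' →
          ∃ a, ∃ _ : a ∈ {z ∈ B | ¬ (p : ℤ) ∣ z.1 - D * z.2},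
          ((a.1 - D * a.2).natAbs, (a.1 + a.2).natAbs) = (c, d) := by
        rintro d' hd ⟨f, hf⟩ hq
        have hd2 : d' ^ 2 = (d : ℤ) ^ 2 := by rw [← hd]; simp
        have e1 : d' - f - D * f = c := by linear_combination hf + f * hpD'
        have ho : Odd (d' - f) := by
          have : d' - f = c + D * f := by linarith
          rw [this]
          exact (by exact_mod_cast h1 : Odd (c : ℤ)).add_even (hDe.mul_right f)
        refine ⟨(d' - f, f), ⟨⟨⟨?_, ho, ?_⟩, ?_⟩, ?_⟩, ?_⟩
        · simp only; rw [e1]; exact hc0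
        · rw [← hQQ' _ _ ho]; simpa using hq
        · simp only
          apply mul_left_cancel₀ hp0
          rw [← h5', ← hd2, ← e1, hpD']; ring
        · simp only; rw [e1]; exact hcp
        · simp only; rw [e1]; simpa using hd
      rcases hp'.dvd_or_dvd h6 with h | h
      · exact key d (by simp) h h3
      · refine key (-d) (by simp) ?_ (hQ _ h3)
        rw [← dvd_neg]; simpa [add_comm] using h
  -- If p ∣ e − Df then M = pN and e + f√-D = (g + h√-D)(1 − √-D), where (g, h) is a solution for N
  -- with g > 0.
  have hB2 : (({z ∈ B | (p : ℤ) ∣ z.1 - D * z.2}.ncard : ℕ) : ZMod 2) =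
      if Q 0 ∧ ∃ x : ℕ, Odd x ∧ M = p * x ^ 2 then 1 else 0 := by
    by_cases hpM : p ∣ M
    · obtain ⟨N, rfl⟩ := hpM
      have hC := ncard_right_half_plane hDpos N Q hQ
      have e : (∃ x : ℕ, Odd x ∧ (N : ℤ) = (x : ℤ) ^ 2) ↔ (∃ x : ℕ, Odd x ∧ p * N = p * x ^ 2) := by
        refine exists_congr fun x => and_congr_right fun _ => ?_
        rw [Nat.mul_right_inj hp.ne_zero]; norm_cast
      rw [← e, ← hC]
      congr 1
      symm
      refine Set.ncard_congr (fun z _ => (z.1 + D * z.2, z.2 - z.1)) ?_ ?_ ?_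
      · rintro ⟨g, h⟩ ⟨⟨h1, h2, h3⟩, h4⟩
        simp only [hB, Set.mem_ofPred_eq] at *
        have e1 : g + D * h - D * (h - g) = p * g := by rw [hpD']; ring
        refine ⟨⟨⟨?_, ?_, ?_⟩, ?_⟩, ?_⟩
        · rw [e1]; exact mul_pos (by omega) h1
        · exact h2.add_even (hDe.mul_right h)
        · have := (hQQ' g (h - g) h2).1 (by simpa using h3)
          exact this
        · push_cast; rw [← h4, hpD']; ring
        · rw [e1]; exact Dvd.intro _ rfl
      · rintro ⟨g, h⟩ ⟨g', h'⟩ _ _ hh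
        simp only [Prod.mk.injEq] at *
        have : (p : ℤ) * (h - h') = 0 := by rw [hpD']; linear_combination hh.1 + hh.2
        rcases mul_eq_zero.1 this with h | h
        · exact absurd h hp0
        · omega
      · rintro ⟨e, f⟩ ⟨⟨⟨h1, h2, h3⟩, h4⟩, ⟨g, hg⟩⟩
        simp only at *
        have e1 : e = g + D * (f + g) := by linear_combination hg + g * hpD'
        have hg0 : 0 < g := by
          rw [hg] at h1
          exact pos_of_mul_pos_right h1 (by omega)
        have hgo : Odd g := by
          by_contra hne
          rw [Int.not_odd_iff_even] at hne
          rw [e1] at h2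
          exact (Int.not_odd_iff_even.2 (hne.add (hDe.mul_right _))) h2
        refine ⟨(g, f + g), ⟨⟨hg0, hgo, ?_⟩, ?_⟩, ?_⟩
        · simp only; rw [add_comm]; exact (hQQ' g f hgo).2 h3
        · simp only
          apply mul_left_cancel₀ hp0
          push_cast at h4
          rw [← h4, e1, hpD']; ring
        · simp [e1]
    · have h1 : {z ∈ B | (p : ℤ) ∣ z.1 - D * z.2} = ∅ := by
        ext ⟨e, f⟩
        simp only [hB, Set.mem_ofPred_eq, Set.mem_empty_iff_false, iff_false]
        rintro ⟨⟨-, h4⟩, h5⟩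
        apply hpM
        have : (p : ℤ) ∣ M := by
          rw [← h4]
          obtain ⟨g, hg⟩ := h5
          refine ⟨D * f ^ 2 + g * (e + D * f), ?_⟩
          linear_combination (e + D * f) * hg - D * f ^ 2 * hpD'
        exact_mod_cast this
      rw [h1, if_neg]
      · simp
      · rintro ⟨_, x, _, rfl⟩; exact hpM (Dvd.intro _ rfl)
  have hBt := ncard_half_plane hDpos hDe M Q' hQ'
  rw [show (∃ x : ℕ, Odd x ∧ (M : ℤ) = (x : ℤ) ^ 2) ↔ (∃ x : ℕ, Odd x ∧ M = x ^ 2) by norm_cast]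
    at hBt
  change ((B.ncard : ℕ) : ZMod 2) = _ at hBt
  rw [← hBt, ← hB2, ← hB1]
  have h1 : B = {z ∈ B | ¬ (p : ℤ) ∣ z.1 - D * z.2} ∪ {z ∈ B | (p : ℤ) ∣ z.1 - D * z.2} := by
    ext z; by_cases h : (p : ℤ) ∣ z.1 - D * z.2 <;> simp [h]
  have h2 : Disjoint {z ∈ B | ¬ (p : ℤ) ∣ z.1 - D * z.2} {z ∈ B | (p : ℤ) ∣ z.1 - D * z.2} := by
    rw [Set.disjoint_left]; rintro z ⟨_, h⟩ ⟨_, h'⟩; exact h h'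
  have h3 : (B.ncard : ZMod 2) = ({z ∈ B | ¬ (p : ℤ) ∣ z.1 - D * z.2}.ncard : ZMod 2) +
      ({z ∈ B | (p : ℤ) ∣ z.1 - D * z.2}.ncard : ZMod 2) := by
    conv_lhs => rw [h1, Set.ncard_union_eq h2 (hBfin.subset (Set.sep_subset _ _))
      (hBfin.subset (Set.sep_subset _ _)), Nat.cast_add]
  rw [h3, add_assoc, CharTwo.add_self_eq_zero, add_zero]
end HeckeModTwo

/-! ### Theta series mod 2. -/

namespace HeckeModTwo
open PowerSeries Finset

instance charP_powerSeries_zmod_two : CharP (PowerSeries (ZMod 2)) 2 :=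
  charP_of_injective_algebraMap (algebraMap (ZMod 2) (PowerSeries (ZMod 2))).injective 2

open Classical in
/-- The theta series `∑ q^(a x^2)` over the natural numbers `x` with `P x`, mod 2. -/
noncomputable def thetaSeries (a : ℕ) (P : ℕ → Prop) : PowerSeries (ZMod 2) :=
  PowerSeries.mk fun n => if ∃ x, P x ∧ n = a * x ^ 2 then 1 else 0

open Classical in
theorem coeff_thetaSeries (a : ℕ) (P : ℕ → Prop) (n : ℕ) :
    coeff n (thetaSeries a P) = if ∃ x, P x ∧ n = a * x ^ 2 then 1 else 0 := by
  simp [thetaSeries]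

theorem delta_eq_thetaSeries : Delta = thetaSeries 1 Odd := by
  ext n
  rw [coeff_thetaSeries, Delta, coeff_mk]
  congr 1
  refine propext ⟨?_, ?_⟩
  · rintro ⟨m, rfl⟩; exact ⟨_, odd_two_mul_add_one m, by ring⟩
  · rintro ⟨_, ⟨m, rfl⟩, rfl⟩; exact ⟨m, by ring⟩

theorem thetaSeries_add {a : ℕ} (ha : a ≠ 0) {P Q : ℕ → Prop} (h : ∀ x, P x → ¬ Q x) :
    thetaSeries a P + thetaSeries a Q = thetaSeries a fun x => P x ∨ Q x := by
  ext n
  simp only [map_add, coeff_thetaSeries]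
  by_cases h1 : ∃ x, P x ∧ n = a * x ^ 2
  · obtain ⟨x, hx, rfl⟩ := h1
    have h2 : ¬ ∃ y, Q y ∧ a * x ^ 2 = a * y ^ 2 := by
      rintro ⟨y, hy, hxy⟩
      have : x = y := by simpa [ha] using hxy
      subst this; exact h x hx hy
    rw [if_pos ⟨x, hx, rfl⟩, if_neg h2, if_pos ⟨x, Or.inl hx, rfl⟩, add_zero]
  · rw [if_neg h1, zero_add]
    congr 1
    refine propext ⟨?_, ?_⟩
    · rintro ⟨x, hx, rfl⟩; exact ⟨x, Or.inr hx, rfl⟩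
    · rintro ⟨x, hx | hx, rfl⟩
      · exact absurd ⟨x, hx, rfl⟩ h1
      · exact ⟨x, hx, rfl⟩

theorem thetaSeries_congr {a : ℕ} {P Q : ℕ → Prop} (h : ∀ x, P x ↔ Q x) :
    thetaSeries a P = thetaSeries a Q := by
  rw [funext fun x => propext (h x)]

theorem expand_thetaSeries {p : ℕ} (hp : p ≠ 0) (a : ℕ) (P : ℕ → Prop) :
    expand p hp (thetaSeries a P) = thetaSeries (p * a) P := by
  ext n
  rw [coeff_expand, coeff_thetaSeries, coeff_thetaSeries]
  by_cases h : p ∣ n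
  · obtain ⟨m, rfl⟩ := h
    rw [if_pos (Dvd.intro _ rfl), Nat.mul_div_cancel_left _ (Nat.pos_of_ne_zero hp)]
    congr 1
    refine propext (exists_congr fun x => and_congr_right fun _ => ?_)
    rw [mul_assoc, Nat.mul_right_inj hp]
  · rw [if_neg h, if_neg]
    rintro ⟨x, _, rfl⟩
    exact h ⟨a * x ^ 2, by ring⟩

/-- Squaring is the substitution `q ↦ q^2`. -/
theorem expand_two (f : PowerSeries (ZMod 2)) : expand 2 two_ne_zero f = f ^ 2 := by
  ext n
  rw [coeff_expand, sq, coeff_mul]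
  have hz : ∀ z : ZMod 2, z * z = z := by decide
  have h : ∑ x ∈ (antidiagonal n).filter (fun x => ¬ x.1 = x.2), coeff x.1 f * coeff x.2 f = 0 := by
    refine Finset.sum_involution (fun x _ => (x.2, x.1)) ?_ ?_ ?_ ?_
    · intro x _
      simp only [mul_comm (coeff x.2 f)]; exact CharTwo.add_self_eq_zero _
    · rintro ⟨x, y⟩ hx _ h
      simp only [mem_filter, Prod.mk.injEq] at *
      exact hx.2 h.2
    · rintro ⟨x, y⟩ hx
      simp only [mem_filter, HasAntidiagonal.mem_antidiagonal] at *
      omega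
    · rintro ⟨x, y⟩ hx; rfl
  rw [← Finset.sum_filter_add_sum_filter_not _ (fun x : ℕ × ℕ => x.1 = x.2), h, add_zero]
  split_ifs with hn
  · obtain ⟨m, rfl⟩ := hn
    rw [show (antidiagonal (2 * m)).filter (fun x => x.1 = x.2) = {(m, m)} by
      ext ⟨x, y⟩; simp only [mem_filter, HasAntidiagonal.mem_antidiagonal, mem_singleton, Prod.mk.injEq]; omega]
    simp [hz]
  · rw [show (antidiagonal n).filter (fun x => x.1 = x.2) = ∅ by
      ext ⟨x, y⟩; simp only [mem_filter, HasAntidiagonal.mem_antidiagonal, notMem_empty, iff_false]; omega]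
    simp

theorem thetaSeries_sq (a : ℕ) (P : ℕ → Prop) : thetaSeries a P ^ 2 = thetaSeries (2 * a) P := by
  rw [← expand_two, expand_thetaSeries]

theorem thetaSeries_pow_two_pow (a : ℕ) (P : ℕ → Prop) (i : ℕ) :
    thetaSeries a P ^ 2 ^ i = thetaSeries (2 ^ i * a) P := by
  induction i with
  | zero => simp
  | succ i ih => rw [pow_succ, pow_mul, ih, thetaSeries_sq]; congr 1; ring

theorem coeff_thetaSeries_mul {a b : ℕ} (ha : 0 < a) (hb : 0 < b) (P Q : ℕ → Prop) (n : ℕ) :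
    coeff n (thetaSeries a P * thetaSeries b Q) =
      (({z : ℕ × ℕ | (P z.1 ∧ Q z.2) ∧ a * z.1 ^ 2 + b * z.2 ^ 2 = n}.ncard : ℕ) : ZMod 2) := by
  classical
  rw [coeff_mul]
  simp only [coeff_thetaSeries, ← ite_and, mul_ite, mul_one, mul_zero]
  rw [Finset.sum_boole]
  congr 1
  rw [← Set.ncard_coe_finset]
  symm
  refine Set.ncard_congr (fun z _ => (a * z.1 ^ 2, b * z.2 ^ 2)) ?_ ?_ ?_
  · rintro ⟨x, y⟩ ⟨⟨h1, h2⟩, h3⟩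
    simp only [coe_filter, HasAntidiagonal.mem_antidiagonal, Set.mem_ofPred_eq] at *
    exact ⟨h3, ⟨y, h2, rfl⟩, ⟨x, h1, rfl⟩⟩
  · rintro ⟨x, y⟩ ⟨x', y'⟩ _ _ h
    simpa [ha.ne', hb.ne'] using h
  · rintro ⟨u, v⟩ h
    simp only [coe_filter, HasAntidiagonal.mem_antidiagonal, Set.mem_ofPred_eq] at h
    obtain ⟨h1, ⟨y, hy, rfl⟩, ⟨x, hx, rfl⟩⟩ := h
    exact ⟨(x, y), ⟨⟨hx, hy⟩, h1⟩, rfl⟩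
end HeckeModTwo

/-! ### The modular equations of levels 3 and 5. -/

namespace HeckeModTwo
open PowerSeries Finset

theorem thetaSeries_and_dvd (a : ℕ) {p : ℕ} {P : ℕ → Prop} (h : ∀ x, P (p * x) ↔ P x) :
    (thetaSeries a fun x => P x ∧ p ∣ x) = thetaSeries (a * p ^ 2) P := by
  ext n
  simp only [coeff_thetaSeries]
  congr 1
  refine propext ⟨?_, ?_⟩
  · rintro ⟨_, ⟨hx, y, rfl⟩, rfl⟩; exact ⟨y, (h y).1 hx, by ring⟩
  · rintro ⟨x, hx, rfl⟩; exact ⟨p * x, ⟨(h x).2 hx, Dvd.intro _ rfl⟩, by ring⟩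

/-- Descent on the index: a coefficient is either zero or repeated at the smaller index n/p. This is
what proves the modular equations without any appeal to modular forms. -/
theorem eq_zero_of_eq_expand {R : Type*} [CommRing R] {p : ℕ} (hp : 1 < p) {f : PowerSeries R}
    (h0 : coeff 0 f = 0) (h : f = expand p (by omega) f) : f = 0 := by
  ext n
  induction n using Nat.strong_induction_on with
  | _ n ih =>
    rcases Nat.eq_zero_or_pos n with rfl | hn
    · simpa using h0
    · rw [h, coeff_expand]
      split_ifs with hd
      · exact ih _ (Nat.div_lt_self hn hp)
      · simp

/-- `Δ(q) = g + Δ(q^9)` with `g^3 = Δ(q^3)`. -/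
theorem thetaSeries_three_cube :
    (thetaSeries 1 fun x => Odd x ∧ ¬ 3 ∣ x) ^ 3 = thetaSeries 3 Odd := by
  rw [pow_succ' _ 2, thetaSeries_sq]
  ext n
  rw [coeff_thetaSeries_mul one_pos (by norm_num), coeff_thetaSeries]
  have hsq : ∀ x, ¬ 3 ∣ x → x ^ 2 % 3 = 1 := by
    intro x hx
    have : x % 3 = 1 ∨ x % 3 = 2 := by omega
    rcases this with h | h <;> simp [Nat.pow_mod, h]
  by_cases hn : 3 ∣ n
  · obtain ⟨M, rfl⟩ := hn
    -- g³ = g·g² counts x² + 2y² = n. The second coordinate e + f is odd with e odd, so f is even;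
    -- as 0 is not odd, only the term of Δ(q³) remains.
    have h := ncard_norm_prime_mul (p := 3) (D := 2) (by norm_num) rfl (by norm_num) (by norm_num)
      (fun f => Odd f) (fun f => Even f) (by simp) (by simp)
      (fun e f he => by simp [Int.odd_add, he]) M
    simp only [Even.zero, true_and, Int.not_odd_zero, false_and, if_false, add_zero] at h
    convert h using 3
    · ext ⟨x, y⟩
      simp only [Set.mem_ofPred_eq, Int.odd_coe_nat]
      constructor
      · rintro ⟨⟨⟨h1, h2⟩, h3, h4⟩, h5⟩
        exact ⟨⟨h1, h3.pos, h3, h2⟩, by simpa using h5⟩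
      · rintro ⟨⟨h1, h2, h3, h4⟩, h5⟩
        refine ⟨⟨⟨h1, h4⟩, h3, ?_⟩, by simpa using h5⟩
        rintro ⟨z, rfl⟩
        have := hsq x h4
        have h6 : 2 * (3 * z) ^ 2 = 3 * (6 * z ^ 2) := by ring
        omega
    · rw [and_iff_right Even.zero]
      refine exists_congr fun x => and_congr_right fun _ => ?_
      omega
  · rw [if_neg]
    · convert Nat.cast_zero
      rw [Set.ncard_eq_zero (finite_norm_eq_nat (by norm_num) (by norm_num) _ _)]
      ext ⟨x, y⟩
      simp only [Set.mem_ofPred_eq, Set.mem_empty_iff_false, iff_false]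
      rintro ⟨⟨⟨h1, h2⟩, h3, h4⟩, h5⟩
      have := hsq x h2
      have := hsq y h4
      omega
    · rintro ⟨x, -, rfl⟩; exact hn (Dvd.intro _ rfl)

theorem sq_mod_five_of_one {x : ℕ} (hx : x % 5 = 1 ∨ x % 5 = 4) : x ^ 2 % 5 = 1 := by
  rcases hx with h | h <;> simp [Nat.pow_mod, h]

theorem sq_mod_five_of_two {x : ℕ} (hx : x % 5 = 2 ∨ x % 5 = 3) : x ^ 2 % 5 = 4 := by
  rcases hx with h | h <;> simp [Nat.pow_mod, h]

/-- Modulo 5 the form is c² − d², so c ≡ ±d; in particular c and d have the same quadratic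
character. -/
theorem mod_five_of_norm {c d M : ℕ} (h : c ^ 2 + 4 * d ^ 2 = 5 * M) (hc : ¬ 5 ∣ c) :
    c % 5 = d % 5 ∨ c % 5 + d % 5 = 5 := by
  have h1 : (c ^ 2 + 4 * d ^ 2) % 5 = 0 := by rw [h]; simp
  have hc' : c % 5 ≠ 0 := by omega
  have hcl : c % 5 < 5 := Nat.mod_lt _ (by norm_num)
  have hdl : d % 5 < 5 := Nat.mod_lt _ (by norm_num)
  rw [Nat.add_mod, Nat.mul_mod, Nat.pow_mod, Nat.pow_mod d] at h1
  generalize c % 5 = u at *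
  generalize d % 5 = v at *
  interval_cases u <;> interval_cases v <;> simp at h1 hc' ⊢

/-- Odd numbers that are squares mod `5`. -/
def OddResidue (x : ℕ) : Prop := Odd x ∧ (x % 5 = 1 ∨ x % 5 = 4)

/-- Odd numbers that are nonsquares mod `5`. -/
def OddNonresidue (x : ℕ) : Prop := Odd x ∧ (x % 5 = 2 ∨ x % 5 = 3)

/-- A fifth power is g·g⁴ and counts x² + 4y² = n. When 5 ∣ n and 5 ∤ x, both coordinates lie in the
same quadratic class mod 5, so the two fifth powers together count all odd solutions with 5 ∤ x. -/
theorem thetaSeries_five_fifth_pow :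
    thetaSeries 1 OddResidue ^ 5 + thetaSeries 1 OddNonresidue ^ 5 = thetaSeries 5 Odd := by
  have e : ∀ P, thetaSeries 1 P ^ 5 = thetaSeries 1 P * thetaSeries 4 P := by
    intro P
    rw [pow_succ' _ 4, show 4 = 2 ^ 2 by norm_num, thetaSeries_pow_two_pow, mul_one]
  rw [e, e]
  ext n
  rw [map_add, coeff_thetaSeries_mul one_pos (by norm_num),
    coeff_thetaSeries_mul one_pos (by norm_num), coeff_thetaSeries, ← Nat.cast_add,
    ← Set.ncard_union_eq _ (finite_norm_eq_nat (by norm_num) (by norm_num) _ _)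
      (finite_norm_eq_nat (by norm_num) (by norm_num) _ _)]
  swap
  · rw [Set.disjoint_left]
    rintro ⟨x, y⟩ ⟨⟨⟨_, h⟩, _⟩, _⟩ ⟨⟨⟨_, h'⟩, _⟩, _⟩
    simp only at *
    omega
  by_cases hn : 5 ∣ n
  · obtain ⟨M, rfl⟩ := hn
    have h := ncard_norm_prime_mul (p := 5) (D := 4) (by norm_num) rfl (by norm_num) (by decide)
      (fun f => Odd f) (fun f => Even f) (by simp) (by simp)
      (fun e f he => by simp [Int.odd_add, he]) M
    simp only [Even.zero, true_and, Int.not_odd_zero, false_and, if_false, add_zero] at h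
    convert h using 3
    · ext ⟨x, y⟩
      simp only [Set.mem_union, Set.mem_ofPred_eq, Int.odd_coe_nat, OddResidue, OddNonresidue]
      constructor
      · rintro (⟨⟨⟨h1, h2⟩, h3, h4⟩, h5⟩ | ⟨⟨⟨h1, h2⟩, h3, h4⟩, h5⟩) <;>
        exact ⟨⟨h1, h3.pos, h3, by omega⟩, by simpa using h5⟩
      · rintro ⟨⟨h1, h2, h3, h4⟩, h5⟩
        have := mod_five_of_norm h5 h4
        simp only [h1, h3, true_and, one_mul, h5, and_true]
        omega
    · rw [and_iff_right Even.zero]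
      refine exists_congr fun x => and_congr_right fun _ => ?_
      omega
  · rw [if_neg]
    · convert Nat.cast_zero
      rw [Set.ncard_eq_zero ((finite_norm_eq_nat (by norm_num) (by norm_num) _ _).union
        (finite_norm_eq_nat (by norm_num) (by norm_num) _ _))]
      ext ⟨x, y⟩
      simp only [Set.mem_union, Set.mem_ofPred_eq, Set.mem_empty_iff_false, iff_false]
      rintro (⟨⟨⟨h1, h2⟩, h3, h4⟩, h5⟩ | ⟨⟨⟨h1, h2⟩, h3, h4⟩, h5⟩)
      · have := sq_mod_five_of_one h2
        have := sq_mod_five_of_one h4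
        omega
      · have := sq_mod_five_of_two h2
        have := sq_mod_five_of_two h4
        omega
    · rintro ⟨x, -, rfl⟩; exact hn (Dvd.intro _ rfl)

/-- (c − 2d)² + (c + 2d)² = 2(c² + 4d²). As c ≡ ±d mod 5, the numbers c ± 2d are −c and 3c in some
order; −1 is a square mod 5 and 3 is not, so one is a residue and the other a nonresidue. -/
theorem ncard_residue_nonresidue (M : ℕ) :
    {z : ℕ × ℕ | (OddResidue z.1 ∧ OddNonresidue z.2) ∧ 1 * z.1 ^ 2 + 1 * z.2 ^ 2 = 10 * M}.ncard =
    {z : ℕ × ℕ | (Odd z.1 ∧ 0 < z.2 ∧ True ∧ ¬ 5 ∣ z.1) ∧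
      z.1 ^ 2 + 4 * z.2 ^ 2 = 5 * M}.ncard := by
  symm
  refine Set.ncard_congr (fun z _ =>
    if ((z.1 : ℤ) - 2 * z.2).natAbs % 5 = 1 ∨ ((z.1 : ℤ) - 2 * z.2).natAbs % 5 = 4 then
      (((z.1 : ℤ) - 2 * z.2).natAbs, z.1 + 2 * z.2) else
      (z.1 + 2 * z.2, ((z.1 : ℤ) - 2 * z.2).natAbs)) ?_ ?_ ?_
  · rintro ⟨c, d⟩ ⟨⟨h1, h2, -, h4⟩, h5⟩
    simp only [Set.mem_ofPred_eq, OddResidue, OddNonresidue, Nat.odd_iff] at *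
    have h6 := mod_five_of_norm h5 h4
    have h7 : (((c : ℤ) - 2 * d).natAbs) ^ 2 + (c + 2 * d) ^ 2 = 10 * M := by
      zify at h5 ⊢
      simp only [sq_abs]
      linear_combination 2 * h5
    have hc5 : c % 5 = 1 ∨ c % 5 = 2 ∨ c % 5 = 3 ∨ c % 5 = 4 := by omega
    split_ifs with h
    · exact ⟨by dsimp only; rcases hc5 with h8 | h8 | h8 | h8 <;> rw [h8] at h6 <;> omega,
        by simpa using h7⟩
    · exact ⟨by dsimp only; rcases hc5 with h8 | h8 | h8 | h8 <;> rw [h8] at h6 <;> omega,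
        by simpa [add_comm] using h7⟩
  · rintro ⟨c, d⟩ ⟨c', d'⟩ ⟨⟨h1, h2, -, h4⟩, h5⟩ ⟨⟨h1', h2', -, h4'⟩, h5'⟩ h
    simp only [Nat.odd_iff] at *
    split_ifs at h <;> simp only [Prod.mk.injEq] at h ⊢ <;> omega
  · rintro ⟨x, y⟩ ⟨⟨⟨h1, h2⟩, h3, h4⟩, h5⟩
    rw [Nat.odd_iff] at h1 h3
    simp only at h1 h2 h3 h4 h5
    have key : ∀ c d : ℕ, c % 2 = 1 → 0 < d → (c + 2 * d = x ∧ ((c : ℤ) - 2 * d).natAbs = y ∨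
        c + 2 * d = y ∧ ((c : ℤ) - 2 * d).natAbs = x) →
        ∃ a, ∃ _ : a ∈ {z : ℕ × ℕ | (Odd z.1 ∧ 0 < z.2 ∧ True ∧ ¬ 5 ∣ z.1) ∧
          z.1 ^ 2 + 4 * z.2 ^ 2 = 5 * M},
          (if ((a.1 : ℤ) - 2 * a.2).natAbs % 5 = 1 ∨ ((a.1 : ℤ) - 2 * a.2).natAbs % 5 = 4 then
            (((a.1 : ℤ) - 2 * a.2).natAbs, a.1 + 2 * a.2) else
            (a.1 + 2 * a.2, ((a.1 : ℤ) - 2 * a.2).natAbs)) = (x, y) := by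
      intro c d hc hd h
      refine ⟨(c, d), ⟨⟨Nat.odd_iff.2 hc, hd, trivial, ?_⟩, ?_⟩, ?_⟩
      · simp only; omega
      · simp only
        have h7 : (((c : ℤ) - 2 * d).natAbs) ^ 2 + (c + 2 * d) ^ 2 = 10 * M := by
          rcases h with ⟨ha, hb⟩ | ⟨ha, hb⟩ <;> rw [ha, hb] <;> omega
        zify at h7 ⊢
        simp only [sq_abs] at h7
        linarith
      · simp only
        split_ifs <;> simp only [Prod.mk.injEq] <;> omega
    -- For x, y odd exactly one of (x + y)/2 and |x − y|/2 is odd; it is c, and the other is 2d.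
    rcases le_total x y with hxy | hxy
    · by_cases hp : (x + y) / 2 % 2 = 1
      · exact key ((x + y) / 2) ((y - x) / 4) hp (by omega) (by omega)
      · exact key ((y - x) / 2) ((x + y) / 4) (by omega) (by omega) (by omega)
    · by_cases hp : (x + y) / 2 % 2 = 1
      · exact key ((x + y) / 2) ((x - y) / 4) hp (by omega) (by omega)
      · exact key ((x - y) / 2) ((x + y) / 4) (by omega) (by omega) (by omega)

/-- Here d has no parity condition, so both terms of `ncard_norm_prime_mul` survive. They give
Δ(q^10) + Δ(q^50), which is the square on the right. -/
theorem thetaSeries_five_mul :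
    thetaSeries 1 OddResidue * thetaSeries 1 OddNonresidue =
      (thetaSeries 5 Odd + thetaSeries 25 Odd) ^ 2 := by
  rw [CharTwo.add_sq, thetaSeries_sq, thetaSeries_sq]
  ext n
  rw [coeff_thetaSeries_mul one_pos one_pos, map_add, coeff_thetaSeries, coeff_thetaSeries]
  by_cases hn : 10 ∣ n
  · obtain ⟨M, rfl⟩ := hn
    have h := ncard_norm_prime_mul (p := 5) (D := 4) (by norm_num) rfl (by norm_num) (by decide)
      (fun f => True) (fun f => True) (by simp) (by simp) (by simp) M
    rw [ncard_residue_nonresidue]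
    refine h.trans ?_
    congr 2
    · simp only [true_and]
      refine propext (exists_congr fun x => and_congr_right fun _ => ?_)
      omega
    · simp only [true_and]
      refine propext (exists_congr fun x => and_congr_right fun _ => ?_)
      omega
  · rw [if_neg, if_neg, add_zero]
    · convert Nat.cast_zero
      rw [Set.ncard_eq_zero (finite_norm_eq_nat (by norm_num) (by norm_num) _ _)]
      ext ⟨x, y⟩
      simp only [Set.mem_ofPred_eq, Set.mem_empty_iff_false, iff_false]
      rintro ⟨⟨⟨h1, h2⟩, h3, h4⟩, h5⟩
      have := sq_mod_five_of_one h2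
      have := sq_mod_five_of_two h4
      have := Nat.odd_iff.1 (h1.pow (n := 2))
      have := Nat.odd_iff.1 (h3.pow (n := 2))
      omega
    · rintro ⟨x, -, rfl⟩; exact hn ⟨5 * x ^ 2, by ring⟩
    · rintro ⟨x, -, rfl⟩; exact hn ⟨x ^ 2, by ring⟩

theorem coeff_zero_thetaSeries_odd {a : ℕ} (ha : a ≠ 0) : coeff 0 (thetaSeries a Odd) = 0 := by
  rw [coeff_thetaSeries, if_neg]
  rintro ⟨x, hx, h⟩
  have := hx.pos
  have : 0 < a * x ^ 2 := by positivity
  omega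

/-- The modular equation of level `3`. -/
theorem modular_equation_three :
    (Delta + thetaSeries 3 Odd) ^ 4 = Delta * thetaSeries 3 Odd := by
  have h2 : (2 : PowerSeries (ZMod 2)) = 0 := CharTwo.two_eq_zero
  set d := (Delta + thetaSeries 3 Odd) ^ 4 + Delta * thetaSeries 3 Odd with hd
  have hsplit : Delta = (thetaSeries 1 fun x => Odd x ∧ ¬ 3 ∣ x) + thetaSeries 9 Odd := by
    have h9 : (thetaSeries 1 fun x => Odd x ∧ 3 ∣ x) = thetaSeries 9 Odd :=
      thetaSeries_and_dvd 1 (p := 3) (P := Odd) fun x => by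
        rw [Nat.odd_mul]; exact and_iff_right (by decide)
    rw [← h9, thetaSeries_add one_ne_zero (by tauto), delta_eq_thetaSeries]
    exact thetaSeries_congr fun x => by tauto
  have hcube := thetaSeries_three_cube
  -- With g the part of Δ of exponents prime to 3, d + d(q³) = g⁴ + g·Δ(q³), which vanishes because
  -- g³ = Δ(q³).
  have hexp : d = expand 3 (by norm_num) d := by
    rw [hd]
    simp only [map_add, map_mul, map_pow, delta_eq_thetaSeries, expand_thetaSeries]
    rw [← delta_eq_thetaSeries, hsplit]
    norm_num
    generalize (thetaSeries 1 fun x => Odd x ∧ ¬ 3 ∣ x) = g at *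
    generalize thetaSeries 3 Odd = b at *
    generalize thetaSeries 9 Odd = c at *
    grind
  have h0 : d = 0 := by
    refine eq_zero_of_eq_expand (by norm_num) ?_ hexp
    rw [hd]
    have h1 : constantCoeff Delta = 0 := by
      rw [← coeff_zero_eq_constantCoeff_apply, delta_eq_thetaSeries]
      exact coeff_zero_thetaSeries_odd one_ne_zero
    have h3 : constantCoeff (thetaSeries 3 Odd) = 0 := by
      rw [← coeff_zero_eq_constantCoeff_apply]; exact coeff_zero_thetaSeries_odd (by norm_num)
    rw [coeff_zero_eq_constantCoeff_apply]
    simp [h1, h3]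
  exact CharTwo.add_eq_zero.1 h0

/-- The modular equation of level `5`. -/
theorem modular_equation_five :
    (Delta + thetaSeries 5 Odd) ^ 6 = Delta * thetaSeries 5 Odd := by
  have h2 : (2 : PowerSeries (ZMod 2)) = 0 := CharTwo.two_eq_zero
  set d := (Delta + thetaSeries 5 Odd) ^ 6 + Delta * thetaSeries 5 Odd with hd
  have hsplit : Delta = thetaSeries 1 OddResidue + thetaSeries 1 OddNonresidue +
      thetaSeries 25 Odd := by
    have h9 : (thetaSeries 1 fun x => Odd x ∧ 5 ∣ x) = thetaSeries 25 Odd :=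
      thetaSeries_and_dvd 1 (p := 5) (P := Odd) fun x => by
        rw [Nat.odd_mul]; exact and_iff_right (by decide)
    rw [← h9, thetaSeries_add one_ne_zero, thetaSeries_add one_ne_zero, delta_eq_thetaSeries]
    · exact thetaSeries_congr fun x => by
        simp only [OddResidue, OddNonresidue, ← and_or_left]
        rw [iff_self_and]
        intro; omega
    · rintro x (⟨-, h⟩ | ⟨-, h⟩) ⟨-, h'⟩ <;> omega
    · rintro x ⟨-, h⟩ ⟨-, h'⟩; omega
  have hfifth := thetaSeries_five_fifth_pow
  have hmul := thetaSeries_five_mul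
  have hexp : d = expand 5 (by norm_num) d := by
    rw [hd]
    simp only [map_add, map_mul, map_pow, delta_eq_thetaSeries, expand_thetaSeries]
    rw [← delta_eq_thetaSeries, hsplit]
    norm_num
    generalize thetaSeries 1 OddResidue = g at *
    generalize thetaSeries 1 OddNonresidue = k at *
    generalize thetaSeries 5 Odd = b at *
    generalize thetaSeries 25 Odd = c at *
    -- This is s⁵ + s³t + st² = g⁵ + k⁵ mod 2, for s = g + k and t = gk = (b + c)². Multiplied by s
    -- it says d + d(q⁵) = 0.
    have key : (g + k) ^ 5 + (b + c) ^ 2 * (g + k) ^ 3 + (b + c) ^ 4 * (g + k) = b := by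
      rw [show (b + c) ^ 4 = ((b + c) ^ 2) ^ 2 by ring, ← hmul]
      linear_combination hfifth +
        h2 * (3 * g ^ 4 * k + 7 * g ^ 3 * k ^ 2 + 7 * g ^ 2 * k ^ 3 + 3 * g * k ^ 4)
    generalize hW : g + k = W at *
    linear_combination W * key + h2 * (3 * W ^ 5 * (b + c) + 7 * W ^ 4 * (b + c) ^ 2 +
      10 * W ^ 3 * (b + c) ^ 3 + 7 * W ^ 2 * (b + c) ^ 4 + 3 * W * (b + c) ^ 5 + W * b)
  have h0 : d = 0 := by
    refine eq_zero_of_eq_expand (by norm_num) ?_ hexp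
    rw [hd]
    have h1 : constantCoeff Delta = 0 := by
      rw [← coeff_zero_eq_constantCoeff_apply, delta_eq_thetaSeries]
      exact coeff_zero_thetaSeries_odd one_ne_zero
    have h3 : constantCoeff (thetaSeries 5 Odd) = 0 := by
      rw [← coeff_zero_eq_constantCoeff_apply]; exact coeff_zero_thetaSeries_odd (by norm_num)
    rw [coeff_zero_eq_constantCoeff_apply]
    simp [h1, h3]
  exact CharTwo.add_eq_zero.1 h0
end HeckeModTwo

/-! ### Hecke operators on power series and their recurrences. -/

namespace HeckeModTwo
open PowerSeries Finset

/-- The operator `U_p` extracting the coefficients of index divisible by `p`. -/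
noncomputable def operatorU (p : ℕ) : Module.End (ZMod 2) (PowerSeries (ZMod 2)) where
  toFun f := PowerSeries.mk fun n => coeff (p * n) f
  map_add' f g := by ext n; simp
  map_smul' c f := by ext n; simp

@[simp]
theorem coeff_operatorU (p n : ℕ) (f : PowerSeries (ZMod 2)) :
    coeff n (operatorU p f) = coeff (p * n) f := by
  simp [operatorU]

theorem coeff_heckeT (p n : ℕ) (f : PowerSeries (ZMod 2)) :
    coeff n (heckeT p f) = coeff (p * n) f + if p ∣ n then coeff (n / p) f else 0 := by
  simp [heckeT]

theorem heckeT_eq {p : ℕ} (hp : p ≠ 0) (f : PowerSeries (ZMod 2)) :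
    heckeT p f = operatorU p f + expand p hp f := by
  ext n
  rw [coeff_heckeT, map_add, coeff_operatorU, coeff_expand]

/-- `expand p` of g has exponents divisible by p only, so it passes through U_p as g. A polynomial
relation between Δ and Δ(q^p) thus becomes a recurrence for U_p. -/
theorem operatorU_expand_mul {p : ℕ} (hp : p ≠ 0) (g f : PowerSeries (ZMod 2)) :
    operatorU p (expand p hp g * f) = g * operatorU p f := by
  ext n
  rw [coeff_operatorU, coeff_mul, coeff_mul]
  symm
  refine Finset.sum_of_injOn (fun x => (p * x.1, p * x.2)) ?_ ?_ ?_ ?_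
  · rintro ⟨x, y⟩ _ ⟨x', y'⟩ _ h
    simpa [hp] using h
  · rintro ⟨x, y⟩ h
    simp only [mem_coe, HasAntidiagonal.mem_antidiagonal] at *
    rw [← h]; ring
  · rintro ⟨x, y⟩ h h'
    simp only [HasAntidiagonal.mem_antidiagonal, Set.mem_image, mem_coe, Prod.mk.injEq,
      Prod.exists] at *
    rw [coeff_expand, if_neg, zero_mul]
    rintro ⟨a, rfl⟩
    obtain ⟨b, rfl⟩ : p ∣ y := (Nat.dvd_add_right (Dvd.intro _ rfl)).1 (h ▸ Dvd.intro _ rfl)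
    refine h' ⟨a, b, ?_, rfl, rfl⟩
    rw [← mul_add] at h
    exact Nat.eq_of_mul_eq_mul_left (Nat.pos_of_ne_zero hp) h
  · rintro ⟨x, y⟩ h
    simp only [coeff_operatorU]
    rw [coeff_expand_mul]

/-- Squaring is q ↦ q² in characteristic 2, and this commutes with T_p for p odd. Even powers of Δ
are thereby reduced to lower ones. -/
theorem heckeT_sq {p : ℕ} (hp : Odd p) (f : PowerSeries (ZMod 2)) :
    heckeT p (f ^ 2) = heckeT p f ^ 2 := by
  have hp0 : p ≠ 0 := hp.pos.ne'
  rw [heckeT_eq hp0, heckeT_eq hp0, CharTwo.add_sq, map_pow (expand p hp0)]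
  congr 1
  rw [← expand_two, ← expand_two]
  ext n
  rw [coeff_operatorU, coeff_expand, coeff_expand]
  have h2 : 2 ∣ p * n ↔ 2 ∣ n :=
    (Nat.Coprime.dvd_mul_left (Nat.coprime_two_left.2 hp))
  by_cases h : 2 ∣ n
  · rw [if_pos h, if_pos (h2.2 h), coeff_operatorU, Nat.mul_div_assoc _ h]
  · rw [if_neg h, if_neg (fun h' => h (h2.1 h'))]

theorem heckeT_one {p : ℕ} (hp : p ≠ 0) : heckeT p 1 = 0 := by
  have h := operatorU_expand_mul hp 1 1
  have h1 : operatorU p 1 = 1 := by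
    ext n
    simp [coeff_one, hp]
  rw [heckeT_eq hp, h1, map_one, CharTwo.add_self_eq_zero]

theorem heckeT_comm {p r : ℕ} (hpr : Nat.Coprime p r) (hp : p ≠ 0) (hr : r ≠ 0) :
    heckeT p * heckeT r = heckeT r * heckeT p := by
  have key : ∀ {p r : ℕ}, Nat.Coprime p r → p ≠ 0 → r ≠ 0 → ∀ (f : PowerSeries (ZMod 2)) n,
      coeff n (heckeT p (heckeT r f)) = coeff (p * r * n) f +
        (if r ∣ n then coeff (p * (n / r)) f else 0) +
        (if p ∣ n then coeff (r * (n / p)) f else 0) +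
        (if p * r ∣ n then coeff (n / (p * r)) f else 0) := by
    intro p r hpr hp hr f n
    rw [coeff_heckeT, coeff_heckeT, coeff_heckeT]
    have h1 : r ∣ p * n ↔ r ∣ n := Nat.Coprime.dvd_mul_left hpr.symm
    have h2 : (if r ∣ p * n then coeff (p * n / r) f else 0) =
        if r ∣ n then coeff (p * (n / r)) f else 0 := by
      by_cases h : r ∣ n
      · rw [if_pos h, if_pos (h1.2 h), Nat.mul_div_assoc _ h]
      · rw [if_neg h, if_neg (fun h' => h (h1.1 h'))]
    rw [h2, ← mul_assoc, mul_comm r p, add_assoc (_ + _)]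
    congr 1
    by_cases hpn : p ∣ n
    · obtain ⟨m, rfl⟩ := hpn
      rw [if_pos (Dvd.intro _ rfl), if_pos (Dvd.intro _ rfl),
        Nat.mul_div_cancel_left _ (Nat.pos_of_ne_zero hp)]
      simp only [Nat.mul_dvd_mul_iff_left (Nat.pos_of_ne_zero hp),
        Nat.mul_div_mul_left _ _ (Nat.pos_of_ne_zero hp)]
    · rw [if_neg hpn, if_neg hpn, if_neg (fun h => hpn (dvd_of_mul_right_dvd h)), add_zero]
  ext f n
  rw [Module.End.mul_apply, Module.End.mul_apply, key hpr hp hr, key hpr.symm hr hp, mul_comm r p]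
  ring

theorem expand_delta {p : ℕ} (hp : p ≠ 0) : expand p hp Delta = thetaSeries p Odd := by
  rw [delta_eq_thetaSeries, expand_thetaSeries, mul_one]

/-- The recurrence for `T_3` given by the modular equation of level `3`. -/
theorem heckeT_three_rec (i : ℕ) (f : PowerSeries (ZMod 2)) :
    heckeT 3 (Delta ^ (4 * 2 ^ i) * f) =
      Delta ^ 2 ^ i * heckeT 3 (Delta ^ 2 ^ i * f) + Delta ^ (4 * 2 ^ i) * heckeT 3 f := by
  have h2 : (2 : PowerSeries (ZMod 2)) = 0 := CharTwo.two_eq_zero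
  have h3 : (3 : ℕ) ≠ 0 := by norm_num
  have hZ := expand_delta h3
  set Z := thetaSeries 3 Odd with hZd
  have h : Delta ^ (4 * 2 ^ i) + Z ^ (4 * 2 ^ i) = Delta ^ 2 ^ i * Z ^ 2 ^ i := by
    have := congr_arg (· ^ 2 ^ i) modular_equation_three
    simp only [mul_pow] at this
    rw [← this, ← pow_mul, show 4 * 2 ^ i = 2 ^ (i + 2) by ring, add_pow_char_pow]
  have hU : operatorU 3 (Delta ^ (4 * 2 ^ i) * f) =
      Delta ^ 2 ^ i * operatorU 3 (Delta ^ 2 ^ i * f) + Delta ^ (4 * 2 ^ i) * operatorU 3 f := by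
    have e : Delta ^ (4 * 2 ^ i) * f = expand 3 h3 (Delta ^ 2 ^ i) * (Delta ^ 2 ^ i * f) +
        expand 3 h3 (Delta ^ (4 * 2 ^ i)) * f := by
      rw [map_pow, map_pow, hZ]
      linear_combination f * h - f * Z ^ (4 * 2 ^ i) * h2
    rw [e, map_add, operatorU_expand_mul, operatorU_expand_mul]
  -- The relation `h` is symmetric in Δ and Z, so `expand` satisfies the same recurrence as U₃, and
  -- so does their sum T₃.
  rw [heckeT_eq h3, heckeT_eq h3, heckeT_eq h3, hU, map_mul (expand 3 h3),
    map_mul (expand 3 h3), map_pow, map_pow, hZ]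
  linear_combination (expand 3 h3 f) * h - expand 3 h3 f * Delta ^ (4 * 2 ^ i) * h2

/-- The recurrence for `T_5` given by the modular equation of level `5`. -/
theorem heckeT_five_rec (f : PowerSeries (ZMod 2)) :
    heckeT 5 (Delta ^ 6 * f) =
      Delta ^ 2 * heckeT 5 (Delta ^ 4 * f) + Delta ^ 4 * heckeT 5 (Delta ^ 2 * f) +
      Delta * heckeT 5 (Delta * f) + Delta ^ 6 * heckeT 5 f := by
  have h2 : (2 : PowerSeries (ZMod 2)) = 0 := CharTwo.two_eq_zero
  have h5 : (5 : ℕ) ≠ 0 := by norm_num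
  have hZ := expand_delta h5
  set Z := thetaSeries 5 Odd with hZd
  have h : Delta ^ 6 + Delta ^ 4 * Z ^ 2 + Delta ^ 2 * Z ^ 4 + Z ^ 6 = Delta * Z := by
    linear_combination modular_equation_five - h2 * (3 * Delta ^ 5 * Z + 7 * Delta ^ 4 * Z ^ 2 +
      10 * Delta ^ 3 * Z ^ 3 + 7 * Delta ^ 2 * Z ^ 4 + 3 * Delta * Z ^ 5)
  have hU : operatorU 5 (Delta ^ 6 * f) =
      Delta ^ 2 * operatorU 5 (Delta ^ 4 * f) + Delta ^ 4 * operatorU 5 (Delta ^ 2 * f) +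
      Delta * operatorU 5 (Delta * f) + Delta ^ 6 * operatorU 5 f := by
    have e : Delta ^ 6 * f = expand 5 h5 (Delta ^ 2) * (Delta ^ 4 * f) +
        expand 5 h5 (Delta ^ 4) * (Delta ^ 2 * f) + expand 5 h5 Delta * (Delta * f) +
        expand 5 h5 (Delta ^ 6) * f := by
      rw [map_pow, map_pow, map_pow, hZ]
      linear_combination f * h - f * (Delta ^ 4 * Z ^ 2 + Delta ^ 2 * Z ^ 4 + Z ^ 6) * h2
    rw [e, map_add, map_add, map_add, operatorU_expand_mul, operatorU_expand_mul,
      operatorU_expand_mul, operatorU_expand_mul]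
  simp only [heckeT_eq h5, hU, map_mul, map_pow, hZ]
  linear_combination (expand 5 h5 f) * h -
    expand 5 h5 f * (Delta ^ 6 + Delta ^ 4 * Z ^ 2 + Delta ^ 2 * Z ^ 4) * h2

/-! ### T_p on the powers Δ^(1 + 2^i). -/

/-- The Hecke operator on the theta series of `x^2 + D y^2` with `x, y` odd: the solutions
divisible by `p` cancel. -/
theorem coeff_heckeT_thetaSeries {p D : ℕ} (hp : p.Prime) (hp2 : p ≠ 2) (hD : 0 < D) (hpD : ¬ p ∣ D)
    (n : ℕ) : coeff n (heckeT p (thetaSeries 1 Odd * thetaSeries D Odd)) =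
      (({z : ℕ × ℕ | (Odd z.1 ∧ Odd z.2 ∧ ¬ p ∣ z.1) ∧
        z.1 ^ 2 + D * z.2 ^ 2 = p * n}.ncard : ℕ) : ZMod 2) := by
  have hpo : Odd p := hp.odd_of_ne_two hp2
  rw [coeff_heckeT, coeff_thetaSeries_mul one_pos hD]
  simp only [one_mul]
  set S := {z : ℕ × ℕ | (Odd z.1 ∧ Odd z.2) ∧ z.1 ^ 2 + D * z.2 ^ 2 = p * n} with hS
  have hfin : S.Finite := by
    simpa using finite_norm_eq_nat one_pos hD (p * n) fun z => Odd z.1 ∧ Odd z.2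
  have h1 : S = {z ∈ S | ¬ p ∣ z.1} ∪ {z ∈ S | p ∣ z.1} := by
    ext z; by_cases h : p ∣ z.1 <;> simp [h]
  have h2 : Disjoint {z ∈ S | ¬ p ∣ z.1} {z ∈ S | p ∣ z.1} := by
    rw [Set.disjoint_left]; rintro z ⟨_, h⟩ ⟨_, h'⟩; exact h h'
  have h3 : (S.ncard : ZMod 2) = ({z ∈ S | ¬ p ∣ z.1}.ncard : ZMod 2) +
      ({z ∈ S | p ∣ z.1}.ncard : ZMod 2) := by
    conv_lhs => rw [h1, Set.ncard_union_eq h2 (hfin.subset (Set.sep_subset _ _))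
      (hfin.subset (Set.sep_subset _ _)), Nat.cast_add]
  -- If p ∣ x then p ∣ y, as p ∤ D. Such solutions are p times the solutions for n/p, which is the
  -- second term of T_p.
  have h4 : ({z ∈ S | p ∣ z.1}.ncard : ZMod 2) =
      if p ∣ n then coeff (n / p) (thetaSeries 1 Odd * thetaSeries D Odd) else 0 := by
    split_ifs with hn
    · obtain ⟨m, rfl⟩ := hn
      rw [Nat.mul_div_cancel_left _ hp.pos, coeff_thetaSeries_mul one_pos hD]
      congr 1
      symm
      refine Set.ncard_congr (fun z _ => (p * z.1, p * z.2)) ?_ ?_ ?_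
      · rintro ⟨x, y⟩ ⟨⟨hx, hy⟩, h⟩
        exact ⟨⟨⟨hpo.mul hx, hpo.mul hy⟩, by simp only at *; rw [← h]; ring⟩, Dvd.intro _ rfl⟩
      · rintro ⟨x, y⟩ ⟨x', y'⟩ _ _ h
        simpa [hp.ne_zero] using h
      · rintro ⟨x, y⟩ ⟨⟨⟨hx, hy⟩, h⟩, ⟨u, hu⟩⟩
        simp only at *
        subst hu
        have hd : p ∣ D * y ^ 2 :=
          (Nat.dvd_add_right ⟨p * u ^ 2, by ring⟩).1 (h ▸ Dvd.intro _ rfl)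
        obtain ⟨v, rfl⟩ := hp.dvd_of_dvd_pow ((hp.dvd_mul.1 hd).resolve_left hpD)
        refine ⟨(u, v), ⟨⟨(Nat.odd_mul.1 hx).2, (Nat.odd_mul.1 hy).2⟩, ?_⟩, rfl⟩
        have hpp : 0 < p * p := Nat.mul_pos hp.pos hp.pos
        apply Nat.eq_of_mul_eq_mul_left hpp
        simp only
        linarith
    · convert Nat.cast_zero
      rw [Set.ncard_eq_zero (hfin.subset (Set.sep_subset _ _))]
      ext ⟨x, y⟩
      simp only [hS, Set.mem_ofPred_eq, Set.mem_empty_iff_false, iff_false]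
      rintro ⟨⟨⟨hx, hy⟩, h⟩, ⟨u, rfl⟩⟩
      have hd : p ∣ D * y ^ 2 :=
        (Nat.dvd_add_right ⟨p * u ^ 2, by ring⟩).1 (h ▸ Dvd.intro _ rfl)
      obtain ⟨v, rfl⟩ := hp.dvd_of_dvd_pow ((hp.dvd_mul.1 hd).resolve_left hpD)
      apply hn
      refine ⟨u ^ 2 + D * v ^ 2, ?_⟩
      apply Nat.eq_of_mul_eq_mul_left hp.pos
      linarith
  rw [h3, h4, add_assoc, CharTwo.add_self_eq_zero, add_zero]
  congr 2
  ext z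
  simp only [hS, Set.mem_ofPred_eq]
  tauto

theorem heckeT_thetaSeries_eq_zero {p D : ℕ} (hp : p.Prime) (hp2 : p ≠ 2) (hD : 0 < D)
    (hpD : ¬ p ∣ D) (h : ∀ x y : ℕ, p ∣ x ^ 2 + D * y ^ 2 → p ∣ x) :
    heckeT p (thetaSeries 1 Odd * thetaSeries D Odd) = 0 := by
  ext n
  rw [coeff_heckeT_thetaSeries hp hp2 hD hpD, map_zero]
  have he : {z : ℕ × ℕ | (Odd z.1 ∧ Odd z.2 ∧ ¬ p ∣ z.1) ∧ z.1 ^ 2 + D * z.2 ^ 2 = p * n} = ∅ := by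
    ext ⟨x, y⟩
    simp only [Set.mem_ofPred_eq, Set.mem_empty_iff_false, iff_false]
    rintro ⟨⟨-, -, h1⟩, h2⟩
    exact h1 (h x y (h2 ▸ Dvd.intro _ rfl))
  rw [he, Set.ncard_empty, Nat.cast_zero]

theorem heckeT_thetaSeries_eq_delta {p D : ℕ} (hp : p.Prime) (hpD : p = D + 1) (hD : 0 < D)
    (hD2 : Even D) : heckeT p (thetaSeries 1 Odd * thetaSeries D Odd) = Delta := by
  ext n
  have hp2 : p ≠ 2 := by rintro rfl; obtain ⟨k, hk⟩ := hD2; omega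
  rw [coeff_heckeT_thetaSeries hp hp2 hD (fun h => by have := Nat.le_of_dvd hD h; omega),
    delta_eq_thetaSeries, coeff_thetaSeries]
  have h := ncard_norm_prime_mul hp hpD hD hD2
      (fun f => Odd f) (fun f => Even f) (by simp) (by simp)
      (fun e f he => by simp [Int.odd_add, he]) n
  refine Eq.trans ?_ (h.trans ?_)
  · congr 2
    ext ⟨x, y⟩
    simp only [Set.mem_ofPred_eq, Int.odd_coe_nat]
    have : Odd y → 0 < y := fun h => h.pos
    tauto
  · have ho : ¬ (Odd (0 : ℤ) ∧ ∃ x, Odd x ∧ n = p * x ^ 2) := fun h' => Int.not_odd_zero h'.1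
    rw [if_neg ho, add_zero]
    congr 1
    simp only [one_mul, eq_iff_iff]
    exact and_iff_right Even.zero

theorem heckeT_delta {p : ℕ} (hp : p.Prime) (hp2 : p ≠ 2) : heckeT p Delta = 0 := by
  have hpo : Odd p := hp.odd_of_ne_two hp2
  ext n
  rw [coeff_heckeT, delta_eq_thetaSeries, coeff_thetaSeries, coeff_thetaSeries, map_zero]
  have h : (∃ x, Odd x ∧ p * n = 1 * x ^ 2) ↔ p ∣ n ∧ ∃ x, Odd x ∧ n / p = 1 * x ^ 2 := by
    constructor
    · rintro ⟨x, hx, h⟩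
      have hd : p ∣ x ^ 2 := ⟨n, by linarith⟩
      obtain ⟨y, rfl⟩ := hp.dvd_of_dvd_pow hd
      have hn : n = p * y ^ 2 := by
        apply Nat.eq_of_mul_eq_mul_left hp.pos
        linarith
      exact ⟨⟨_, hn⟩, y, (Nat.odd_mul.1 hx).2, by rw [hn, Nat.mul_div_cancel_left _ hp.pos]; ring⟩
    · rintro ⟨⟨m, rfl⟩, x, hx, h⟩
      rw [Nat.mul_div_cancel_left _ hp.pos] at h
      exact ⟨p * x, hpo.mul hx, by rw [h]; ring⟩
  by_cases h1 : p ∣ n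
  · rw [if_pos h1]
    simp only [h1, true_and] at h
    by_cases h2 : ∃ x, Odd x ∧ n / p = 1 * x ^ 2
    · rw [if_pos h2, if_pos (h.2 h2)]; exact CharTwo.add_self_eq_zero _
    · rw [if_neg h2, if_neg (fun h' => h2 (h.1 h')), add_zero]
  · rw [if_neg (fun h' => h1 (h.1 h').1), if_neg h1, add_zero]

/-- By Frobenius Δ^(2^i) = Δ(q^(2^i)), so this power counts representations by x² + 2^i y² with x, y
odd. -/
theorem delta_pow_eq_thetaSeries_mul (i : ℕ) :
    Delta ^ (1 + 2 ^ i) = thetaSeries 1 Odd * thetaSeries (2 ^ i) Odd := by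
  rw [pow_add, pow_one, delta_eq_thetaSeries, thetaSeries_pow_two_pow, mul_one]

theorem heckeT_three_delta_cube : heckeT 3 (Delta ^ 3) = Delta := by
  rw [show 3 = 1 + 2 ^ 1 by norm_num, delta_pow_eq_thetaSeries_mul]
  exact heckeT_thetaSeries_eq_delta (by norm_num) rfl (by norm_num) (by decide)

theorem heckeT_five_delta_fifth : heckeT 5 (Delta ^ 5) = Delta := by
  have h := delta_pow_eq_thetaSeries_mul 2
  norm_num at h
  rw [h]
  exact heckeT_thetaSeries_eq_delta (by norm_num) rfl (by norm_num) (by decide)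

theorem heckeT_five_delta_cube : heckeT 5 (Delta ^ 3) = 0 := by
  rw [show 3 = 1 + 2 ^ 1 by norm_num, delta_pow_eq_thetaSeries_mul]
  refine heckeT_thetaSeries_eq_zero (by norm_num) (by norm_num) (by norm_num) (by norm_num) ?_
  intro x y h
  have h1 : (x ^ 2 + 2 ^ 1 * y ^ 2) % 5 = 0 := Nat.mod_eq_zero_of_dvd h
  have hcl : x % 5 < 5 := Nat.mod_lt _ (by norm_num)
  have hdl : y % 5 < 5 := Nat.mod_lt _ (by norm_num)
  rw [Nat.add_mod, Nat.mul_mod, Nat.pow_mod, Nat.pow_mod y] at h1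
  apply Nat.dvd_of_mod_eq_zero
  generalize x % 5 = u at *
  generalize y % 5 = v at *
  interval_cases u <;> interval_cases v <;> simp at h1 ⊢

/-- 4^i ≡ 1 mod 3 and x² + y² is anisotropic mod 3. These powers supply the elements of ker T₃ on
which T₅ is tested. -/
theorem heckeT_three_delta_pow (i : ℕ) : heckeT 3 (Delta ^ (1 + 4 ^ i)) = 0 := by
  have h4 : 4 ^ i = 2 ^ (2 * i) := by rw [pow_mul]; norm_num
  rw [h4, delta_pow_eq_thetaSeries_mul, ← h4]
  have hm : 4 ^ i % 3 = 1 := by rw [Nat.pow_mod]; simp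
  refine heckeT_thetaSeries_eq_zero (by norm_num) (by norm_num) (by positivity) (by omega) ?_
  intro x y h
  have h1 : (x ^ 2 + 4 ^ i * y ^ 2) % 3 = 0 := Nat.mod_eq_zero_of_dvd h
  have hcl : x % 3 < 3 := Nat.mod_lt _ (by norm_num)
  have hdl : y % 3 < 3 := Nat.mod_lt _ (by norm_num)
  rw [Nat.add_mod, Nat.mul_mod, hm, Nat.pow_mod, Nat.pow_mod y] at h1
  apply Nat.dvd_of_mod_eq_zero
  generalize x % 3 = u at *
  generalize y % 3 = v at *
  interval_cases u <;> interval_cases v <;> simp at h1 ⊢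
end HeckeModTwo

/-! ### The space 𝓕 as polynomials in Δ². -/

namespace HeckeModTwo
open PowerSeries

theorem constantCoeff_delta : constantCoeff Delta = 0 := by
  rw [← coeff_zero_eq_constantCoeff_apply, delta_eq_thetaSeries]
  exact coeff_zero_thetaSeries_odd one_ne_zero

theorem coeff_one_delta : coeff 1 Delta = 1 := by
  rw [delta_eq_thetaSeries, coeff_thetaSeries, if_pos ⟨1, odd_one, by norm_num⟩]

theorem delta_ne_zero : Delta ≠ 0 := by
  intro h
  have := coeff_one_delta
  rw [h] at this
  simp at this

/-- The span of the powers `Δ^i` with `i < k` and `i ≡ k mod 2`. -/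
noncomputable def powersBelow (k : ℕ) : Submodule (ZMod 2) (PowerSeries (ZMod 2)) :=
  Submodule.span (ZMod 2) {f | ∃ i, i < k ∧ i % 2 = k % 2 ∧ f = Delta ^ i}

theorem delta_pow_mul_mem_powersBelow {f : PowerSeries (ZMod 2)} {k n : ℕ} (j : ℕ) (h : k + j = n)
    (hf : f ∈ powersBelow k) : Delta ^ j * f ∈ powersBelow n := by
  induction hf using Submodule.span_induction with
  | mem f hf =>
    obtain ⟨i, h1, h2, rfl⟩ := hf
    exact Submodule.subset_span ⟨j + i, by omega, by omega, by rw [pow_add]⟩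
  | zero => simp
  | add f g _ _ hf hg => rw [mul_add]; exact add_mem hf hg
  | smul c f _ hf => rw [mul_smul_comm]; exact Submodule.smul_mem _ _ hf

theorem sq_mem_powersBelow {f : PowerSeries (ZMod 2)} {k : ℕ} (hf : f ∈ powersBelow k) :
    f ^ 2 ∈ powersBelow (2 * k) := by
  induction hf using Submodule.span_induction with
  | mem f hf =>
    obtain ⟨i, h1, h2, rfl⟩ := hf
    exact Submodule.subset_span ⟨2 * i, by omega, by omega, by rw [← pow_mul, mul_comm]⟩
  | zero => simp
  | add f g _ _ hf hg => rw [CharTwo.add_sq]; exact add_mem hf hg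
  | smul c f _ hf => rw [smul_pow]; exact Submodule.smul_mem _ _ hf

theorem delta_pow_mem_powersBelow {i k : ℕ} (h1 : i < k) (h2 : i % 2 = k % 2) :
    Delta ^ i ∈ powersBelow k := Submodule.subset_span ⟨i, h1, h2, rfl⟩

theorem heckeT_even_pow_mem {p : ℕ} (hp : Odd p) {k : ℕ}
    (ih : ∀ j < k, heckeT p (Delta ^ j) ∈ powersBelow j) (hk : Even k) :
    heckeT p (Delta ^ k) ∈ powersBelow k := by
  obtain ⟨j, rfl⟩ := hk
  rcases Nat.eq_zero_or_pos j with rfl | hj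
  · simp [heckeT_one hp.pos.ne']
  · rw [← two_mul, mul_comm, pow_mul, heckeT_sq hp, mul_comm]
    exact sq_mem_powersBelow (ih j (by omega))

/-- Even exponents come from squaring, odd ones from the recurrence, which only involves T₃ of lower
powers. This strict drop gives nilpotency in each bounded degree. -/
theorem heckeT_three_pow_mem (k : ℕ) : heckeT 3 (Delta ^ k) ∈ powersBelow k := by
  induction k using Nat.strong_induction_on with
  | _ k ih =>
    by_cases hk : Even k
    · exact heckeT_even_pow_mem (by decide) ih hk
    rw [Nat.even_iff] at hk
    obtain rfl | rfl | ⟨m, rfl⟩ : k = 1 ∨ k = 3 ∨ ∃ m, k = m + 4 := by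
      by_cases h : 4 ≤ k
      · exact Or.inr (Or.inr ⟨k - 4, by omega⟩)
      · omega
    · rw [pow_one, heckeT_delta (by norm_num) (by norm_num)]; exact zero_mem _
    · rw [heckeT_three_delta_cube]
      simpa using delta_pow_mem_powersBelow (i := 1) (k := 3) (by norm_num) (by norm_num)
    · have h := heckeT_three_rec 0 (Delta ^ m)
      rw [← pow_add, ← pow_add] at h
      norm_num at h
      rw [add_comm m 4, h]
      refine add_mem ?_ (delta_pow_mul_mem_powersBelow 4 (add_comm _ _) (ih m (by omega)))
      have := ih (1 + m) (by omega)
      have h2 := delta_pow_mul_mem_powersBelow 1 rfl this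
      rw [pow_one] at h2
      refine Submodule.span_mono ?_ h2
      rintro f ⟨i, h1, h2, rfl⟩
      exact ⟨i, by omega, by omega, rfl⟩

theorem heckeT_five_pow_mem (k : ℕ) : heckeT 5 (Delta ^ k) ∈ powersBelow k := by
  induction k using Nat.strong_induction_on with
  | _ k ih =>
    by_cases hk : Even k
    · exact heckeT_even_pow_mem (by decide) ih hk
    rw [Nat.even_iff] at hk
    obtain rfl | rfl | rfl | ⟨m, rfl⟩ : k = 1 ∨ k = 3 ∨ k = 5 ∨ ∃ m, k = m + 6 := by
      by_cases h : 6 ≤ k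
      · exact Or.inr (Or.inr (Or.inr ⟨k - 6, by omega⟩))
      · omega
    · rw [pow_one, heckeT_delta (by norm_num) (by norm_num)]; exact zero_mem _
    · rw [heckeT_five_delta_cube]; exact zero_mem _
    · rw [heckeT_five_delta_fifth]
      simpa using delta_pow_mem_powersBelow (i := 1) (k := 5) (by norm_num) (by norm_num)
    · have h := heckeT_five_rec (Delta ^ m)
      rw [← pow_add, ← pow_add, ← pow_add, ← pow_succ'] at h
      rw [add_comm m 6, h]
      refine add_mem (add_mem (add_mem ?_ ?_) ?_) ?_
      · exact delta_pow_mul_mem_powersBelow 2 (by omega) (ih (4 + m) (by omega))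
      · exact delta_pow_mul_mem_powersBelow 4 (by omega) (ih (2 + m) (by omega))
      · have := ih (m + 1) (by omega)
        have h2 := delta_pow_mul_mem_powersBelow 1 rfl this
        rw [pow_one] at h2
        refine Submodule.span_mono ?_ h2
        rintro f ⟨i, h1, h2, rfl⟩
        exact ⟨i, by omega, by omega, rfl⟩
      · exact delta_pow_mul_mem_powersBelow 6 (by omega) (ih m (by omega))

/-- The isomorphism of the polynomial ring with `F`, mapping `X^m` to `Δ^(2m+1)`. -/
noncomputable def oddEval : Polynomial (ZMod 2) →ₗ[ZMod 2] PowerSeries (ZMod 2) :=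
  LinearMap.mulLeft (ZMod 2) Delta ∘ₗ (Polynomial.aeval (Delta ^ 2)).toLinearMap

theorem oddEval_apply (g : Polynomial (ZMod 2)) :
    oddEval g = Delta * Polynomial.aeval (Delta ^ 2) g := rfl

theorem oddEval_X_pow (m : ℕ) : oddEval (Polynomial.X ^ m) = Delta ^ (2 * m + 1) := by
  rw [oddEval_apply, map_pow, Polynomial.aeval_X, ← pow_mul, ← pow_succ']

theorem oddEval_X_pow_mul (m : ℕ) (g : Polynomial (ZMod 2)) :
    oddEval (Polynomial.X ^ m * g) = Delta ^ (2 * m) * oddEval g := by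
  rw [oddEval_apply, oddEval_apply, map_mul, map_pow, Polynomial.aeval_X, ← pow_mul]
  ring

theorem constantCoeff_aeval_delta_sq (g : Polynomial (ZMod 2)) :
    constantCoeff (Polynomial.aeval (Delta ^ 2) g) = g.coeff 0 := by
  induction g using Polynomial.induction_on with
  | C a => simp
  | add f g hf hg => simp [hf, hg]
  | monomial n a _ => simp [constantCoeff_delta]

/-- A nonzero polynomial is X^n h with h(0) ≠ 0, and then h(Δ²) has nonzero constant coefficient
because Δ has none. -/
theorem oddEval_injective : Function.Injective oddEval := by
  rw [← LinearMap.ker_eq_bot, LinearMap.ker_eq_bot']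
  intro g hg
  by_contra hne
  obtain ⟨n, h, hh⟩ := Polynomial.exists_eq_pow_rootMultiplicity_mul_and_not_dvd g hne 0
  rw [map_zero, sub_zero] at h hh
  rw [h, oddEval_X_pow_mul] at hg
  rcases mul_eq_zero.1 hg with h0 | h0
  · exact pow_ne_zero _ delta_ne_zero h0
  · rw [oddEval_apply] at h0
    rcases mul_eq_zero.1 h0 with h0 | h0
    · exact delta_ne_zero h0
    · apply hh
      rw [Polynomial.X_dvd_iff, ← constantCoeff_aeval_delta_sq, h0, map_zero]

theorem range_oddEval : LinearMap.range oddEval = F := by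
  rw [F, ← Submodule.map_top, ← (Polynomial.basisMonomials (ZMod 2)).span_eq, Submodule.map_span,
    ← Set.range_comp]
  congr 1
  congr 1
  ext m
  simp only [Function.comp_apply, Polynomial.coe_basisMonomials, ← oddEval_X_pow,
    Polynomial.X_pow_eq_monomial]

theorem coeff_one_oddEval (g : Polynomial (ZMod 2)) : coeff 1 (oddEval g) = g.coeff 0 := by
  rw [oddEval_apply, coeff_mul, Finset.Nat.antidiagonal_succ]
  simp [constantCoeff_delta, coeff_one_delta, constantCoeff_aeval_delta_sq]

theorem powersBelow_odd (m : ℕ) :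
    powersBelow (2 * m + 1) ≤ (Polynomial.degreeLT (ZMod 2) m).map oddEval := by
  rw [powersBelow, Submodule.span_le]
  rintro f ⟨i, h1, h2, rfl⟩
  refine ⟨Polynomial.X ^ (i / 2), ?_, ?_⟩
  · rw [SetLike.mem_coe, Polynomial.mem_degreeLT, Polynomial.degree_X_pow]
    exact_mod_cast (by omega : i / 2 < m)
  · rw [oddEval_X_pow]; congr 1; omega

/-- An operator that maps each `Δ^k` to a combination of lower powers of the same parity comes
from an operator on polynomials. -/
theorem exists_polynomial_operator {T : Module.End (ZMod 2) (PowerSeries (ZMod 2))}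
    (hT : ∀ k, T (Delta ^ k) ∈ powersBelow k) :
    ∃ S : Module.End (ZMod 2) (Polynomial (ZMod 2)), (∀ g, oddEval (S g) = T (oddEval g)) ∧
      ∀ m, S (Polynomial.X ^ m) ∈ Polynomial.degreeLT (ZMod 2) m := by
  have h : ∀ m, ∃ g ∈ Polynomial.degreeLT (ZMod 2) m, oddEval g = T (Delta ^ (2 * m + 1)) :=
    fun m => powersBelow_odd m (hT _)
  choose s hs1 hs2 using h
  set S := (Polynomial.basisMonomials (ZMod 2)).constr (ZMod 2) s with hS
  have hX : ∀ m, S (Polynomial.X ^ m) = s m := by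
    intro m
    have h := (Polynomial.basisMonomials (ZMod 2)).constr_basis (ZMod 2) s m
    simpa only [Polynomial.coe_basisMonomials, ← Polynomial.X_pow_eq_monomial] using h
  refine ⟨S, ?_, fun m => by rw [hX]; exact hs1 m⟩
  intro g
  have : oddEval ∘ₗ S = T ∘ₗ oddEval := by
    refine (Polynomial.basisMonomials (ZMod 2)).ext fun m => ?_
    simp only [Polynomial.coe_basisMonomials, ← Polynomial.X_pow_eq_monomial,
      LinearMap.comp_apply, hX, hs2, oddEval_X_pow]
  exact LinearMap.congr_fun this g

end HeckeModTwo

/-! ### Binary digits and the weight at √2. -/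

namespace HeckeModTwo

/-- The number whose binary digits are the digits of even position of `m`. -/
def evenBits (m : ℕ) : ℕ := if m = 0 then 0 else m % 2 + 2 * evenBits (m / 4)
decreasing_by omega

/-- The number whose binary digits are the digits of odd position of `m`. -/
def oddBits (m : ℕ) : ℕ := evenBits (m / 2)

theorem evenBits_eq (m : ℕ) : evenBits m = m % 2 + 2 * evenBits (m / 4) := by
  rw [evenBits]
  split_ifs with h
  · subst h; simp [evenBits]
  · rfl

theorem evenBits_two_mul_add (m e : ℕ) (he : e < 2) : evenBits (2 * m + e) = e + 2 * oddBits m := by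
  rw [evenBits_eq, oddBits]
  congr 2
  · omega
  · congr 1; omega

theorem oddBits_two_mul_add (m e : ℕ) (he : e < 2) : oddBits (2 * m + e) = evenBits m := by
  rw [oddBits]; congr 1; omega

theorem testBit_evenBits (m i : ℕ) : (evenBits m).testBit i = m.testBit (2 * i) := by
  induction i generalizing m with
  | zero => rw [evenBits_eq, mul_zero]; simp [Nat.testBit_zero, Nat.add_mod]
  | succ i ih =>
    rw [Nat.testBit_succ, show 2 * (i + 1) = 2 * i + 1 + 1 by ring, Nat.testBit_succ,
      Nat.testBit_succ, Nat.div_div_eq_div_mul, ← ih]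
    congr 1
    rw [evenBits_eq, show 2 * 2 = 4 by norm_num]; omega

theorem testBit_oddBits (m i : ℕ) : (oddBits m).testBit i = m.testBit (2 * i + 1) := by
  rw [oddBits, testBit_evenBits, Nat.testBit_succ]

theorem eq_of_bits_eq {m n : ℕ} (h1 : evenBits m = evenBits n) (h2 : oddBits m = oddBits n) :
    m = n := by
  refine Nat.eq_of_testBit_eq fun i => ?_
  rcases Nat.even_or_odd' i with ⟨k, rfl | rfl⟩
  · rw [← testBit_evenBits, h1, testBit_evenBits]
  · rw [← testBit_oddBits, h2, testBit_oddBits]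

theorem exists_bits_eq (a b : ℕ) : ∃ m, evenBits m = a ∧ oddBits m = b := by
  induction h : a + b using Nat.strong_induction_on generalizing a b with
  | _ n ih =>
    by_cases h0 : n = 0
    · exact ⟨0, by simp [evenBits]; omega, by simp [oddBits, evenBits]; omega⟩
    · obtain ⟨k, h1, h2⟩ := ih (a / 2 + b / 2) (by omega) (a / 2) (b / 2) rfl
      refine ⟨2 * (2 * k + b % 2) + a % 2, ?_, ?_⟩
      · rw [evenBits_two_mul_add _ _ (by omega), oddBits_two_mul_add _ _ (by omega), h1]; omega
      · rw [oddBits_two_mul_add _ _ (by omega), evenBits_two_mul_add _ _ (by omega), h2]; omega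

/-- The value at `√2` of the binary expansion of `m`. -/
noncomputable def weight (m : ℕ) : ℝ := evenBits m + √2 * oddBits m

theorem weight_two_mul_add (m e : ℕ) (he : e < 2) :
    weight (2 * m + e) = e + √2 * weight m := by
  rw [weight, weight, evenBits_two_mul_add _ _ he, oddBits_two_mul_add _ _ he]
  have h : √2 * √2 = 2 := Real.mul_self_sqrt (by norm_num)
  push_cast
  linear_combination (-(oddBits m : ℝ)) * h

theorem bits_eq_of_eq {a b c d : ℕ} (h : (a : ℝ) + √2 * b = c + √2 * d) : a = c ∧ b = d := by
  have hbd : b = d := by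
    by_contra hne
    have hbd : ((b : ℤ) - d : ℤ) ≠ 0 := by omega
    refine irrational_sqrt_two ⟨((c : ℤ) - a : ℤ) / ((b : ℤ) - d : ℤ), ?_⟩
    have : (((b : ℤ) - d : ℤ) : ℝ) ≠ 0 := by exact_mod_cast hbd
    push_cast at this ⊢
    rw [div_eq_iff this]
    linear_combination -h
  subst hbd
  exact ⟨by simpa using h, rfl⟩

theorem weight_injective : Function.Injective weight := fun _ _ h =>
  eq_of_bits_eq (bits_eq_of_eq h).1 (bits_eq_of_eq h).2

/-- A carry trades two units at one place for a single unit at the next, a strict loss because √2 <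
2. Without a carry the weight is additive. -/
theorem weight_add_one (m : ℕ) :
    (m % 2 = 0 → weight (m + 1) = weight m + 1) ∧
    (m % 2 = 1 → weight (m + 1) < weight m + 1) := by
  have hs : √2 < 2 := by
    rw [Real.sqrt_lt' (by norm_num)]; norm_num
  induction m using Nat.strong_induction_on with
  | _ m ih =>
    constructor
    · intro h
      have h1 := weight_two_mul_add (m / 2) 1 (by norm_num)
      have h0 := weight_two_mul_add (m / 2) 0 (by norm_num)
      rw [show 2 * (m / 2) + 1 = m + 1 by omega] at h1
      rw [show 2 * (m / 2) + 0 = m by omega] at h0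
      rw [h1, h0]; push_cast; ring
    · intro h
      have h1 := weight_two_mul_add (m / 2) 1 (by norm_num)
      have h0 := weight_two_mul_add (m / 2 + 1) 0 (by norm_num)
      rw [show 2 * (m / 2) + 1 = m by omega] at h1
      rw [show 2 * (m / 2 + 1) + 0 = m + 1 by omega] at h0
      rw [h1, h0]
      have h2 : weight (m / 2 + 1) ≤ weight (m / 2) + 1 := by
        rcases Nat.mod_two_eq_zero_or_one (m / 2) with h3 | h3
        · exact ((ih (m / 2) (by omega)).1 h3).le
        · exact ((ih (m / 2) (by omega)).2 h3).le
      have := mul_le_mul_of_nonneg_left h2 (Real.sqrt_nonneg 2)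
      push_cast
      linarith

theorem weight_add_two_pow (m j : ℕ) :
    (m.testBit j = false → weight (m + 2 ^ j) = weight m + √2 ^ j) ∧
    (m.testBit j = true → weight (m + 2 ^ j) < weight m + √2 ^ j) := by
  induction j generalizing m with
  | zero => simpa [Nat.testBit_zero] using weight_add_one m
  | succ j ih =>
    have h1 := weight_two_mul_add (m / 2) (m % 2) (Nat.mod_lt _ (by norm_num))
    have h2 := weight_two_mul_add (m / 2 + 2 ^ j) (m % 2) (Nat.mod_lt _ (by norm_num))
    rw [Nat.div_add_mod] at h1
    rw [show 2 * (m / 2 + 2 ^ j) + m % 2 = m + 2 ^ (j + 1) by rw [pow_succ]; omega] at h2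
    rw [Nat.testBit_succ, h1, h2, pow_succ']
    have hs : 0 < √2 := by positivity
    constructor
    · intro h; rw [(ih _).1 h]; ring
    · intro h
      have := mul_lt_mul_of_pos_left ((ih _).2 h) hs
      linarith

theorem weight_add_two_pow_le (m j : ℕ) : weight (m + 2 ^ j) ≤ weight m + √2 ^ j := by
  cases h : m.testBit j
  · exact ((weight_add_two_pow m j).1 h).le
  · exact ((weight_add_two_pow m j).2 h).le

theorem exists_testBit_of_succ_eq {x y : ℕ} (h : x + 1 = y) :
    ∃ i, y.testBit i = true ∧ x.testBit i = false ∧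
      (∀ k < i, x.testBit k = true ∧ y.testBit k = false) ∧
      ∀ k, i < k → x.testBit k = y.testBit k := by
  induction x using Nat.strong_induction_on generalizing y with
  | _ x ih =>
    subst h
    rcases Nat.mod_two_eq_zero_or_one x with hx | hx
    · refine ⟨0, ?_, ?_, by simp, ?_⟩
      · simp only [Nat.testBit_zero, decide_eq_true_eq]; omega
      · simp only [Nat.testBit_zero, decide_eq_false_iff_not]; omega
      · intro k hk
        obtain ⟨k, rfl⟩ := Nat.exists_eq_add_one.2 hk
        rw [Nat.testBit_succ, Nat.testBit_succ]; congr 1; omega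
    · obtain ⟨i, h1, h2, h3, h4⟩ := ih (x / 2) (by omega) (y := (x + 1) / 2) (by omega)
      refine ⟨i + 1, ?_, ?_, ?_, ?_⟩
      · rwa [Nat.testBit_succ]
      · rwa [Nat.testBit_succ]
      · intro k hk
        rcases k with _ | k
        · simp only [Nat.testBit_zero, decide_eq_true_eq, decide_eq_false_iff_not]; omega
        · rw [Nat.testBit_succ, Nat.testBit_succ]; exact h3 k (by omega)
      · intro k hk
        obtain ⟨k, rfl⟩ := Nat.exists_eq_add_one.2 (Nat.zero_lt_of_lt hk)
        rw [Nat.testBit_succ, Nat.testBit_succ]; exact h4 k (by omega)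

/-- The numbers whose weights differ by one. -/
theorem exists_testBit_of_weight {t m : ℕ} (h : weight m = weight t + 1) :
    ∃ i, m.testBit (2 * i) = true ∧ t.testBit (2 * i) = false ∧
      (∀ k < i, t.testBit (2 * k) = true ∧ m.testBit (2 * k) = false) ∧
      ∀ k, Odd k ∨ 2 * i < k → t.testBit k = m.testBit k := by
  have h' : ((evenBits m : ℕ) : ℝ) + √2 * oddBits m = ((evenBits t + 1 : ℕ) : ℝ) + √2 * oddBits t := by
    rw [weight, weight] at h; push_cast; linarith
  obtain ⟨h1, h2⟩ := bits_eq_of_eq h'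
  obtain ⟨i, h3, h4, h5, h6⟩ := exists_testBit_of_succ_eq h1.symm
  simp only [testBit_evenBits] at h3 h4 h5 h6
  refine ⟨i, h3, h4, h5, ?_⟩
  intro k hk
  rcases Nat.even_or_odd' k with ⟨l, rfl | rfl⟩
  · rcases hk with hk | hk
    · exact absurd hk (by simp)
    · exact h6 l (by omega)
  · rw [← testBit_oddBits, ← h2, testBit_oddBits]

end HeckeModTwo

/-! ### T₃ is triangular for the weight. -/

namespace HeckeModTwo

theorem weight_small : weight 0 = 0 ∧ weight 1 = 1 ∧ weight 2 = √2 ∧ weight 3 = 1 + √2 := by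
  have h0 : weight 0 = 0 := by simp [weight, oddBits, evenBits]
  have h1 : weight 1 = 1 := by
    have := weight_two_mul_add 0 1 (by norm_num)
    simpa [h0] using this
  have h2 : weight 2 = √2 := by
    have := weight_two_mul_add 1 0 (by norm_num)
    simpa [h1] using this
  have h3 : weight 3 = 1 + √2 := by
    have := weight_two_mul_add 1 1 (by norm_num)
    simpa [h1] using this
  exact ⟨h0, h1, h2, h3⟩

theorem weight_nonneg (m : ℕ) : 0 ≤ weight m := by unfold weight; positivity

theorem weight_sub_two_pow {t j : ℕ} (h : 2 ^ j ≤ t) :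
    (t.testBit j = true → weight t = weight (t - 2 ^ j) + √2 ^ j) ∧
    (t.testBit j = false → weight t < weight (t - 2 ^ j) + √2 ^ j) := by
  have h1 := weight_add_two_pow (t - 2 ^ j) j
  have h2 := Nat.testBit_two_pow_add_eq (t - 2 ^ j) j
  rw [Nat.add_sub_cancel' h] at h2
  rw [Nat.sub_add_cancel h] at h1
  constructor
  · intro h3; apply h1.1; rw [h2] at h3; simpa using h3
  · intro h3; apply h1.2; rw [h2] at h3; simpa using h3

open Polynomial in
/-- An operator satisfying the recurrence of `T_3` is triangular with respect to the weight: it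
lowers weights by at least one, with leading coefficient one. -/
theorem coeff_of_recurrence {R : Type*} [CommRing R] {S : Module.End R R[X]}
    (hdeg : ∀ m, S (X ^ m) ∈ degreeLT R m)
    (hrec : ∀ j m, S (X ^ (4 * 2 ^ j + m)) =
      X ^ 2 ^ j * S (X ^ (2 ^ j + m)) + X ^ (4 * 2 ^ j) * S (X ^ m))
    (h1 : S (X ^ 1) = 1) (h2 : S (X ^ 2) = 0) (h3 : S (X ^ 3) = X ^ 2) (m t : ℕ) :
    (weight m < weight t + 1 → (S (X ^ m)).coeff t = 0) ∧
    (weight m = weight t + 1 → (S (X ^ m)).coeff t = 1) := by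
  have hcoeff : ∀ m t, m ≤ t → (S (X ^ m)).coeff t = 0 := by
    intro m t h
    have := mem_degreeLT.1 (hdeg m)
    exact coeff_eq_zero_of_degree_lt (this.trans_le (by exact_mod_cast h))
  induction m using Nat.strong_induction_on generalizing t with
  | _ m ih =>
    obtain ⟨w0, w1, w2, w3⟩ := weight_small
    have ht0 := weight_nonneg t
    by_cases hm4 : m < 4
    · obtain rfl | rfl | rfl | rfl : m = 0 ∨ m = 1 ∨ m = 2 ∨ m = 3 := by omega
      · refine ⟨fun _ => hcoeff _ _ (zero_le), fun h => ?_⟩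
        rw [w0] at h; linarith
      · rw [h1, w1]
        refine ⟨fun h => ?_, fun h => ?_⟩
        · rw [coeff_one, if_neg]
          rintro rfl
          rw [w0] at h; linarith
        · have : t = 0 := weight_injective (by rw [w0]; linarith)
          subst this; simp
      · rw [h2]
        refine ⟨fun _ => by simp, fun h => ?_⟩
        obtain ⟨i, hi, -⟩ := exists_testBit_of_weight h
        exfalso
        have := Nat.ge_two_pow_of_testBit hi
        rcases i with _ | i
        · simp at hi
        · rw [show 2 * (i + 1) = 2 * i + 2 by ring, pow_add] at this
          have := Nat.one_le_two_pow (n := 2 * i)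
          omega
      · rw [h3]
        refine ⟨fun h => ?_, fun h => ?_⟩
        · rw [coeff_X_pow, if_neg]
          rintro rfl
          rw [w2, w3] at h; linarith
        · have : t = 2 := weight_injective (by rw [w2]; rw [w3] at h; linarith)
          subst this; simp
    -- 2^(j+2) is the leading binary digit of m, and the recurrence is applied at this j.
    obtain ⟨j, hj1, hj2⟩ : ∃ j, 2 ^ (j + 2) ≤ m ∧ m < 2 ^ (j + 3) := by
      have hl : 2 ≤ Nat.log 2 m := Nat.le_log_of_pow_le (by norm_num) (by omega)
      refine ⟨Nat.log 2 m - 2, ?_, ?_⟩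
      · rw [Nat.sub_add_cancel hl]; exact Nat.pow_log_le_self 2 (by omega)
      · rw [show Nat.log 2 m - 2 + 3 = Nat.log 2 m + 1 by omega]
        exact Nat.lt_pow_succ_log_self (by norm_num) m
    obtain ⟨k, rfl⟩ : ∃ k, m = 2 ^ (j + 2) + k := ⟨m - 2 ^ (j + 2), by omega⟩
    have hk : k < 2 ^ (j + 2) := by rw [pow_succ 2 (j + 2)] at hj2; omega
    have hpow : 2 ^ (j + 2) = 4 * 2 ^ j := by ring
    have hQ : 0 < 2 ^ j := by positivity
    -- The reason for √2: the digit 4·2^j weighs twice as much as 2^j, so both terms of the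
    -- recurrence obey the same weight bound.
    have hs : √2 ^ (j + 2) = 2 * √2 ^ j := by
      rw [pow_add, Real.sq_sqrt (by norm_num)]; ring
    have hwm : weight (2 ^ (j + 2) + k) = weight k + 2 * √2 ^ j := by
      rw [add_comm, (weight_add_two_pow k (j + 2)).1 (Nat.testBit_lt_two_pow hk), hs]
    have hkj := weight_add_two_pow_le k j
    have hco : (S (X ^ (2 ^ (j + 2) + k))).coeff t =
        (if 2 ^ j ≤ t then (S (X ^ (k + 2 ^ j))).coeff (t - 2 ^ j) else 0) +
        (if 2 ^ (j + 2) ≤ t then (S (X ^ k)).coeff (t - 2 ^ (j + 2)) else 0) := by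
      rw [hpow, hrec, coeff_add, coeff_X_pow_mul', coeff_X_pow_mul', add_comm (2 ^ j) k]
    rw [hco]
    constructor
    · intro hlt
      have e1 : (if 2 ^ j ≤ t then (S (X ^ (k + 2 ^ j))).coeff (t - 2 ^ j) else 0) = 0 := by
        split_ifs with h
        · apply (ih (k + 2 ^ j) (by omega) (t - 2 ^ j)).1
          have := weight_add_two_pow_le (t - 2 ^ j) j
          rw [Nat.sub_add_cancel h] at this
          linarith
        · rfl
      have e2 : (if 2 ^ (j + 2) ≤ t then (S (X ^ k)).coeff (t - 2 ^ (j + 2)) else 0) = 0 := by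
        split_ifs with h
        · apply (ih k (by omega) (t - 2 ^ (j + 2))).1
          have := weight_add_two_pow_le (t - 2 ^ (j + 2)) (j + 2)
          rw [Nat.sub_add_cancel h, hs] at this
          linarith
        · rfl
      rw [e1, e2, add_zero]
    · intro heq
      obtain ⟨i, hi1, hi2, hi3, hi4⟩ := exists_testBit_of_weight heq
      have hij : 2 * i ≤ j + 2 := by
        by_contra hlt
        have h1 := Nat.ge_two_pow_of_testBit hi1
        have h2 : 2 ^ (j + 3) ≤ 2 ^ (2 * i) := Nat.pow_le_pow_right (by norm_num) (by omega)
        omega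
      have htlt : t < 2 ^ (j + 3) := by
        apply Nat.lt_pow_two_of_testBit
        intro l hl
        rw [hi4 l (Or.inr (by omega))]
        exact Nat.testBit_lt_two_pow (hj2.trans_le (Nat.pow_le_pow_right (by norm_num) hl))
      have hbj : (2 ^ (j + 2) + k).testBit j = k.testBit j :=
        Nat.testBit_two_pow_add_gt (by omega) k
      have hbj2 : (2 ^ (j + 2) + k).testBit (j + 2) = true := by
        rw [Nat.testBit_two_pow_add_eq, Nat.testBit_lt_two_pow hk]; rfl
      -- Subtracting 1 from the number formed by the even digits of m borrows up to place 2i. If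
      -- that is the leading digit, t lacks 2^(j+2) and only the first term counts; adding 2^j to k
      -- or to t − 2^j involves no carry, so its weight is exact.
      rcases hij.eq_or_lt with hij | hij
      · have htj2 : t < 2 ^ (j + 2) := by
          apply Nat.lt_pow_two_of_testBit
          intro l hl
          rcases eq_or_lt_of_le hl with rfl | hl
          · rwa [← hij]
          · exact Nat.testBit_lt_two_pow (htlt.trans_le (Nat.pow_le_pow_right (by norm_num) hl))
        obtain ⟨hb1, hb2⟩ := hi3 (i - 1) (by omega)
        rw [show 2 * (i - 1) = j by omega] at hb1 hb2
        have htj := Nat.ge_two_pow_of_testBit hb1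
        rw [if_pos htj, if_neg (by omega), add_zero]
        apply (ih (k + 2 ^ j) (by omega) (t - 2 ^ j)).2
        have a1 := (weight_sub_two_pow htj).1 hb1
        have a2 := (weight_add_two_pow k j).1 (hbj ▸ hb2)
        linarith
      -- Otherwise t keeps the leading digit and the second term gives 1. The first gives 0: digit j
      -- of k is 1 or digit j of t is 0, so, when 2^j ≤ t, adding 2^j to k or to t − 2^j carries and
      -- loses weight.
      · have hb : t.testBit (j + 2) = true := by rw [hi4 _ (Or.inr hij), hbj2]
        have htj2 := Nat.ge_two_pow_of_testBit hb
        have e1 : (if 2 ^ j ≤ t then (S (X ^ (k + 2 ^ j))).coeff (t - 2 ^ j) else 0) = 0 := by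
          split_ifs with h
          · apply (ih (k + 2 ^ j) (by omega) (t - 2 ^ j)).1
            have hor : k.testBit j = true ∨ t.testBit j = false := by
              rw [← hbj]
              by_cases hji : j = 2 * i
              · right; rw [hji]; exact hi2
              · have : t.testBit j = (2 ^ (j + 2) + k).testBit j ∨ t.testBit j = false ∨
                    (2 ^ (j + 2) + k).testBit j = true := by
                  rcases Nat.even_or_odd' j with ⟨l, hl | hl⟩
                  · by_cases hli : i < l
                    · left; exact hi4 j (Or.inr (by omega))
                    · exact absurd hij (by omega)
                  · left; exact hi4 j (Or.inl ⟨l, hl⟩)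
                rcases this with h | h | h
                · rw [h]; cases (2 ^ (j + 2) + k).testBit j <;> simp
                · exact Or.inr h
                · exact Or.inl h
            rcases hor with hor | hor
            · have a1 := (weight_add_two_pow k j).2 hor
              have a2 := weight_add_two_pow_le (t - 2 ^ j) j
              rw [Nat.sub_add_cancel h] at a2
              linarith
            · have a1 := (weight_sub_two_pow h).2 hor
              linarith
          · rfl
        rw [e1, zero_add, if_pos htj2]
        apply (ih k (by omega) (t - 2 ^ (j + 2))).2
        have a1 := (weight_sub_two_pow htj2).1 hb
        rw [hs] at a1
        linarith
end HeckeModTwo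

/-! ### Coefficients at powers of 5 and Gaussian integers. -/

namespace HeckeModTwo
open PowerSeries

/-- The coefficients of index `5^(n-1)`, extended to an even sequence vanishing at `0`. -/
noncomputable def fivePowerCoeff (f : PowerSeries (ZMod 2)) (n : ℤ) : ZMod 2 :=
  if n = 0 then 0 else coeff (5 ^ (n.natAbs - 1)) f

theorem fivePowerCoeff_eq (f : PowerSeries (ZMod 2)) {n : ℤ} (k : ℕ) (h : n.natAbs = k + 1) :
    fivePowerCoeff f n = coeff (5 ^ k) f := by
  rw [fivePowerCoeff, if_neg (by omega), h, Nat.add_sub_cancel]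

/-- On these sequences T₅ is the sum of the two unit shifts. The value 0 at n = 0 accounts for
a_1(T₅f) = a_5(f), and evenness extends the formula to all integers. -/
theorem fivePowerCoeff_heckeT (f : PowerSeries (ZMod 2)) (n : ℤ) :
    fivePowerCoeff (heckeT 5 f) n = fivePowerCoeff f (n + 1) + fivePowerCoeff f (n - 1) := by
  have key : ∀ k : ℕ, coeff (5 ^ k) (heckeT 5 f) =
      fivePowerCoeff f ((k + 1 : ℕ) + 1) + fivePowerCoeff f ((k + 1 : ℕ) - 1) := by
    intro k
    rw [coeff_heckeT, ← pow_succ', fivePowerCoeff_eq f (k + 1) (by omega)]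
    congr 1
    rcases k with _ | k
    · simp [fivePowerCoeff]
    · rw [if_pos (dvd_pow_self 5 (by omega)), pow_succ, Nat.mul_div_cancel _ (by norm_num),
        fivePowerCoeff_eq f k (by omega)]
  have heven : ∀ n, fivePowerCoeff f (-n) = fivePowerCoeff f n := by
    intro n; simp [fivePowerCoeff]
  rcases lt_trichotomy n 0 with h | rfl | h
  · obtain ⟨k, hk⟩ : ∃ k : ℕ, n = -(k + 1 : ℕ) := ⟨n.natAbs - 1, by omega⟩
    subst hk
    rw [fivePowerCoeff_eq _ k (by omega), key, add_comm, ← heven, ← heven (_ + 1)]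
    congr 2
    ring
  · rw [zero_add, zero_sub, heven, CharTwo.add_self_eq_zero]; simp [fivePowerCoeff]
  · obtain ⟨k, hk⟩ : ∃ k : ℕ, n = (k + 1 : ℕ) := ⟨n.natAbs - 1, by omega⟩
    subst hk
    rw [fivePowerCoeff_eq _ k (by omega), key]

/-- (σ + σ⁻¹)^(2^i) = σ^(2^i) + σ^(−2^i) for the shift σ, in characteristic 2. -/
theorem fivePowerCoeff_heckeT_pow (i : ℕ) (f : PowerSeries (ZMod 2)) (n : ℤ) :
    fivePowerCoeff ((heckeT 5 ^ 2 ^ i) f) n =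
      fivePowerCoeff f (n + 2 ^ i) + fivePowerCoeff f (n - 2 ^ i) := by
  induction i generalizing f n with
  | zero => simpa using fivePowerCoeff_heckeT f n
  | succ i ih =>
    rw [pow_succ, mul_two, pow_add, Module.End.mul_apply, ih, ih, ih]
    rw [show n + 2 ^ i - 2 ^ i = n by ring, show n - 2 ^ i + 2 ^ i = n by ring,
      show n + 2 ^ i + 2 ^ i = n + 2 ^ (i + 1) by ring,
      show n - 2 ^ i - 2 ^ i = n - 2 ^ (i + 1) by ring]
    linear_combination CharTwo.add_self_eq_zero (fivePowerCoeff f n)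

theorem coeff_one_heckeT_five_pow (i : ℕ) (f : PowerSeries (ZMod 2)) :
    coeff 1 ((heckeT 5 ^ 2 ^ i) f) =
      coeff (5 ^ 2 ^ i) f + if i = 0 then 0 else coeff (5 ^ (2 ^ i - 2)) f := by
  have h := fivePowerCoeff_heckeT_pow i f 1
  have hp : 1 ≤ 2 ^ i := Nat.one_le_two_pow
  have hc : ((2 ^ i : ℕ) : ℤ) = 2 ^ i := by push_cast; rfl
  rw [fivePowerCoeff_eq _ 0 (by simp), pow_zero, fivePowerCoeff_eq f (2 ^ i) (by omega)] at h
  rw [h]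
  congr 1
  rcases i with _ | i
  · simp [fivePowerCoeff]
  · have h2 : 2 ≤ 2 ^ (i + 1) := by rw [pow_succ]; have := Nat.one_le_two_pow (n := i); omega
    rw [if_neg (by omega), fivePowerCoeff_eq f (2 ^ (i + 1) - 2) (by omega)]

open Zsqrtd

/-- The Gaussian integers of norm a power of `5`. -/
theorem gaussianInt_norm_five_pow (n : ℕ) (z : GaussianInt) (hz : z.norm = 5 ^ n) (ho : Odd z.re) :
    ∃ s : ℤ, (s = 1 ∨ s = -1) ∧ ∃ a b, a + b = n ∧
      z = s * ((⟨1, 2⟩ : GaussianInt) ^ a * (⟨1, -2⟩ : GaussianInt) ^ b) := by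
  induction n generalizing z with
  | zero =>
    rw [Zsqrtd.norm_def, pow_zero] at hz
    have h1 : z.re * z.re ≤ 1 := by nlinarith [mul_self_nonneg z.im]
    have h2 : z.re = 1 ∨ z.re = -1 := by
      have : z.re ≠ 0 := by intro h; rw [h] at ho; simp at ho
      have : z.re ≤ 1 := by nlinarith
      have : -1 ≤ z.re := by nlinarith
      omega
    have h3 : z.im = 0 := by
      rcases h2 with h | h <;> rw [h] at hz <;> simpa using hz
    refine ⟨z.re, h2, 0, 0, rfl, ?_⟩
    rw [Zsqrtd.ext_iff]; simp [h3]
  | succ n ih =>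
    rw [Zsqrtd.norm_def] at hz
    -- The product is re² − 4 im² ≡ re² + im² mod 5; the factor divisible by 5 tells which of 1 ± 2i
    -- divides z.
    have hd : (5 : ℤ) ∣ (z.re + 2 * z.im) * (z.re - 2 * z.im) :=
      ⟨5 ^ n - z.im ^ 2, by rw [pow_succ] at hz; linarith⟩
    have h5 : Prime (5 : ℤ) := by norm_num
    rcases h5.dvd_or_dvd hd with ⟨c, hc⟩ | ⟨c, hc⟩
    · have e : z = (⟨1, 2⟩ : GaussianInt) * ⟨c, z.im - 2 * c⟩ := by
        rw [Zsqrtd.ext_iff]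
        simp only [Zsqrtd.re_mul, Zsqrtd.im_mul]
        constructor
        · linarith
        · ring
      have ho' : Odd c := by
        have : Odd (5 * c) := by rw [← hc]; exact ho.add_even (even_two_mul _)
        exact (Int.odd_mul.1 this).2
      have hn : (⟨c, z.im - 2 * c⟩ : GaussianInt).norm = 5 ^ n := by
        rw [Zsqrtd.norm_def]
        simp only
        rw [show z.re = 5 * c - 2 * z.im by linarith, pow_succ] at hz
        linarith
      obtain ⟨s, hs, a, b, hab, hw⟩ := ih _ hn ho'
      refine ⟨s, hs, a + 1, b, by omega, ?_⟩
      rw [e, hw]; ring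
    · have e : z = (⟨1, -2⟩ : GaussianInt) * ⟨c, z.im + 2 * c⟩ := by
        rw [Zsqrtd.ext_iff]
        simp only [Zsqrtd.re_mul, Zsqrtd.im_mul]
        constructor
        · linarith
        · ring
      have ho' : Odd c := by
        have : Odd (5 * c) := by rw [← hc]; exact ho.sub_even (even_two_mul _)
        exact (Int.odd_mul.1 this).2
      have hn : (⟨c, z.im + 2 * c⟩ : GaussianInt).norm = 5 ^ n := by
        rw [Zsqrtd.norm_def]
        simp only
        rw [show z.re = 5 * c + 2 * z.im by linarith, pow_succ] at hz
        linarith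
      obtain ⟨s, hs, a, b, hab, hw⟩ := ih _ hn ho'
      refine ⟨s, hs, a, b + 1, by omega, ?_⟩
      rw [e, hw]; ring

theorem gaussianInt_pow_mod (t : ℕ) :
    Odd ((⟨1, 2⟩ : GaussianInt) ^ t).re ∧ ((⟨1, 2⟩ : GaussianInt) ^ t).im % 4 = 2 * t % 4 := by
  induction t with
  | zero => simp
  | succ t ih =>
    obtain ⟨⟨k, hk⟩, h2⟩ := ih
    rw [pow_succ]
    simp only [Zsqrtd.re_mul, Zsqrtd.im_mul]
    refine ⟨⟨k - ((⟨1, 2⟩ : GaussianInt) ^ t).im, by rw [hk]; ring⟩, ?_⟩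
    push_cast
    omega

/-- Im(z²) = 2 Re(z) Im(z) with Re(z) odd, so doubling the exponent raises the 2-adic valuation of
the imaginary part by exactly one. -/
theorem gaussianInt_pow_im (k o : ℕ) (ho : Odd o) :
    ∃ c : ℤ, Odd c ∧ ((⟨1, 2⟩ : GaussianInt) ^ (2 ^ k * o)).im = 2 ^ (k + 1) * c := by
  induction k with
  | zero =>
    have h := (gaussianInt_pow_mod o).2
    obtain ⟨l, rfl⟩ := ho
    refine ⟨((⟨1, 2⟩ : GaussianInt) ^ (2 * l + 1)).im / 2, ?_, ?_⟩
    · rw [Int.odd_iff]; push_cast at h; omega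
    · rw [pow_zero, one_mul]; push_cast at h; omega
  | succ k ih =>
    obtain ⟨c, hc, h⟩ := ih
    refine ⟨((⟨1, 2⟩ : GaussianInt) ^ (2 ^ k * o)).re * c, (gaussianInt_pow_mod _).1.mul hc, ?_⟩
    rw [show 2 ^ (k + 1) * o = 2 ^ k * o + 2 ^ k * o by ring, pow_add, Zsqrtd.im_mul, h]
    ring

theorem two_pow_mul_odd_inj {i k : ℕ} {a b : ℤ} (ha : Odd a) (hb : Odd b)
    (h : 2 ^ i * a = 2 ^ k * b) : i = k := by
  wlog hik : i ≤ k generalizing i k a b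
  · exact (this hb ha h.symm (by omega)).symm
  obtain ⟨d, rfl⟩ := Nat.exists_eq_add_of_le hik
  rw [pow_add, mul_assoc] at h
  have h' := mul_left_cancel₀ (by positivity) h
  rcases d with _ | d
  · rfl
  · rw [h', pow_succ] at ha
    exact absurd ha (by simp [parity_simps])

/-- Solutions of `x^2 + 4^(i+1) y^2 = 5^n` in odd numbers. -/
theorem sq_add_four_pow_mul_sq {i n : ℕ} {x y : ℕ} (hx : Odd x) (hy : Odd y)
    (h : x ^ 2 + 4 ^ (i + 1) * y ^ 2 = 5 ^ n) :
    2 ^ i ≤ n ∧ (n = 2 ^ i → x = ((⟨1, 2⟩ : GaussianInt) ^ n).re.natAbs ∧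
      2 ^ (i + 1) * y = ((⟨1, 2⟩ : GaussianInt) ^ n).im.natAbs) := by
  have h4 : (4 : ℤ) ^ (i + 1) = 2 ^ (i + 1) * 2 ^ (i + 1) := by rw [← mul_pow]; norm_num
  have hn : (⟨x, 2 ^ (i + 1) * y⟩ : GaussianInt).norm = 5 ^ n := by
    rw [Zsqrtd.norm_def]
    zify at h
    rw [h4] at h
    simp only
    linarith
  obtain ⟨s, hs, a, b, hab, hz⟩ := gaussianInt_norm_five_pow n _ hn
    (by simpa using hx)
  have h5 : (⟨1, 2⟩ : GaussianInt) * ⟨1, -2⟩ = ((5 : ℤ) : GaussianInt) := by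
    rw [Zsqrtd.ext_iff]; simp
  -- As (1 + 2i)(1 − 2i) = 5, the element is 5^l (1 + 2i)^t up to sign and conjugation.
  obtain ⟨l, t, hlt, hre, him⟩ : ∃ l t, n = 2 * l + t ∧
      x = 5 ^ l * ((⟨1, 2⟩ : GaussianInt) ^ t).re.natAbs ∧
      2 ^ (i + 1) * y = 5 ^ l * ((⟨1, 2⟩ : GaussianInt) ^ t).im.natAbs := by
    have hsn : s.natAbs = 1 := by omega
    have hstar : ∀ t : ℕ, (⟨1, -2⟩ : GaussianInt) ^ t = star ((⟨1, 2⟩ : GaussianInt) ^ t) := by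
      intro t
      rw [star_pow]; congr 1
    have fin : ∀ l t : ℕ, ∀ w : GaussianInt, w.re.natAbs = ((⟨1, 2⟩ : GaussianInt) ^ t).re.natAbs →
        w.im.natAbs = ((⟨1, 2⟩ : GaussianInt) ^ t).im.natAbs →
        (⟨x, 2 ^ (i + 1) * y⟩ : GaussianInt) = s * (((5 ^ l : ℤ) : GaussianInt) * w) →
        x = 5 ^ l * ((⟨1, 2⟩ : GaussianInt) ^ t).re.natAbs ∧
        2 ^ (i + 1) * y = 5 ^ l * ((⟨1, 2⟩ : GaussianInt) ^ t).im.natAbs := by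
      intro l t w h1 h2 h3
      rw [Zsqrtd.ext_iff, Zsqrtd.re_smul, Zsqrtd.im_smul, Zsqrtd.re_smul, Zsqrtd.im_smul] at h3
      have ha := congr_arg Int.natAbs h3.1
      have hb := congr_arg Int.natAbs h3.2
      simp only [Int.natAbs_mul, hsn, Int.natAbs_pow, h1, h2, one_mul] at ha hb
      exact ⟨ha, hb⟩
    rcases le_total b a with hba | hba
    · obtain ⟨t, rfl⟩ := Nat.exists_eq_add_of_le hba
      refine ⟨b, t, by omega, fin b t _ rfl rfl ?_⟩
      rw [hz, pow_add, mul_right_comm, ← mul_pow, h5]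
      push_cast; ring
    · obtain ⟨t, rfl⟩ := Nat.exists_eq_add_of_le hba
      refine ⟨a, t, by omega, fin a t (star ((⟨1, 2⟩ : GaussianInt) ^ t)) ?_ ?_ ?_⟩
      · rw [Zsqrtd.re_star]
      · rw [Zsqrtd.im_star, Int.natAbs_neg]
      · rw [hz, pow_add, ← mul_assoc ((⟨1, 2⟩ : GaussianInt) ^ a), ← mul_pow, h5, hstar]
        push_cast; ring
  have ht : t ≠ 0 := by
    rintro rfl
    simp at him
    exact hy.pos.ne' him
  obtain ⟨k, o, ho, hto⟩ := Nat.exists_eq_two_pow_mul_odd ht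
  obtain ⟨c, hc, hk⟩ := gaussianInt_pow_im k o ho
  -- Comparison of 2-adic valuations of the imaginary parts, y and 5^l being odd. So 2^i exactly
  -- divides t, whence 2^i ≤ t ≤ n.
  have hki : i = k := by
    rw [hto, hk, Int.natAbs_mul, Int.natAbs_pow] at him
    have him' : (2 : ℤ) ^ (i + 1) * y = 2 ^ (k + 1) * (5 ^ l * c.natAbs) := by
      zify at him
      push_cast at him ⊢
      rw [him]; simp; ring
    have := two_pow_mul_odd_inj (by exact_mod_cast hy)
      ((Odd.pow (by decide)).mul (by simpa only [Int.odd_coe_nat, Int.natAbs_odd] using hc)) him'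
    omega
  subst hki
  have hle : 2 ^ i ≤ t := by rw [hto]; exact Nat.le_mul_of_pos_right _ ho.pos
  refine ⟨by omega, fun hni => ?_⟩
  have hl : l = 0 := by omega
  subst hl
  rw [show t = n by omega, pow_zero, one_mul] at hre
  rw [show t = n by omega, pow_zero, one_mul] at him
  exact ⟨hre, him⟩

theorem coeff_five_pow_delta_pow (i n : ℕ) (hn : n ≤ 2 ^ i) :
    coeff (5 ^ n) (Delta ^ (1 + 4 ^ (i + 1))) = if n = 2 ^ i then 1 else 0 := by
  have h4 : 4 ^ (i + 1) = 2 ^ (2 * (i + 1)) := by rw [pow_mul]; norm_num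
  rw [h4, delta_pow_eq_thetaSeries_mul, ← h4, coeff_thetaSeries_mul one_pos (by positivity)]
  simp only [one_mul]
  split_ifs with h
  · obtain ⟨c, hc, hk⟩ := gaussianInt_pow_im i 1 odd_one
    rw [mul_one, ← h] at hk
    have : {z : ℕ × ℕ | (Odd z.1 ∧ Odd z.2) ∧ z.1 ^ 2 + 4 ^ (i + 1) * z.2 ^ 2 = 5 ^ n} =
        {(((⟨1, 2⟩ : GaussianInt) ^ n).re.natAbs, c.natAbs)} := by
      ext ⟨x, y⟩
      simp only [Set.mem_ofPred_eq, Set.mem_singleton_iff, Prod.mk.injEq]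
      constructor
      · rintro ⟨⟨hx, hy⟩, hxy⟩
        obtain ⟨h1, h2⟩ := (sq_add_four_pow_mul_sq hx hy hxy).2 h
        refine ⟨h1, ?_⟩
        rw [hk, Int.natAbs_mul, Int.natAbs_pow] at h2
        exact Nat.eq_of_mul_eq_mul_left (by positivity) h2
      · rintro ⟨rfl, rfl⟩
        refine ⟨⟨by simpa using (gaussianInt_pow_mod n).1, by simpa using hc⟩, ?_⟩
        have hnorm : ((⟨1, 2⟩ : GaussianInt) ^ n).norm = 5 ^ n := by
          exact map_pow Zsqrtd.normMonoidHom (⟨1, 2⟩ : GaussianInt) n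
        rw [Zsqrtd.norm_def, hk] at hnorm
        have h4' : (4 : ℤ) ^ (i + 1) = 2 ^ (i + 1) * 2 ^ (i + 1) := by rw [← mul_pow]; norm_num
        zify
        rw [sq_abs, sq_abs, h4']
        linarith
    rw [this]; simp
  · have : {z : ℕ × ℕ | (Odd z.1 ∧ Odd z.2) ∧ z.1 ^ 2 + 4 ^ (i + 1) * z.2 ^ 2 = 5 ^ n} = ∅ := by
      ext ⟨x, y⟩
      simp only [Set.mem_ofPred_eq, Set.mem_empty_iff_false, iff_false]
      rintro ⟨⟨hx, hy⟩, hxy⟩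
      have := (sq_add_four_pow_mul_sq hx hy hxy).1
      omega
    rw [this]; simp

/-- Of the two coefficients that make up the left side, the one at 5^(2^i) is 1, and the one at the
smaller power of 5 vanishes since no solution occurs before exponent 2^i. -/
theorem coeff_one_heckeT_five_delta_pow (i : ℕ) :
    coeff 1 ((heckeT 5 ^ 2 ^ i) (Delta ^ (1 + 4 ^ (i + 1)))) = 1 := by
  have hp : 1 ≤ 2 ^ i := Nat.one_le_two_pow
  have hne : ¬ 2 ^ i - 2 = 2 ^ i := by omega
  rw [coeff_one_heckeT_five_pow, coeff_five_pow_delta_pow _ _ le_rfl, if_pos rfl,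
    coeff_five_pow_delta_pow _ _ (Nat.sub_le _ _), if_neg hne, ite_self, add_zero]
end HeckeModTwo

/-! ### Linear algebra of two commuting lowering operators. -/

namespace HeckeModTwo
open Polynomial

/-- A nilpotent operator on a space of dimension at most `r + 1` whose `r`-th power does not kill
`v` has its kernel spanned by `N^r v`. -/
theorem ker_of_nilpotent_of_finrank_le {K V : Type*} [Field K] [AddCommGroup V] [Module K V]
    [FiniteDimensional K V] {N : Module.End K V} (hN : IsNilpotent N) {r : ℕ}
    (hr : Module.finrank K V ≤ r + 1) {v : V} (hv : (N ^ r) v ≠ 0) :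
    N ^ (r + 1) = 0 ∧ ∀ w, N w = 0 → ∃ c : K, w = c • (N ^ r) v := by
  have hN0 : N ^ (r + 1) = 0 := by
    have h1 : N ^ Module.finrank K V = 0 := by
      have h := LinearMap.aeval_self_charpoly N
      rwa [hN.charpoly_eq_X_pow_finrank, map_pow, aeval_X] at h
    exact pow_eq_zero_of_le hr h1
  refine ⟨hN0, ?_⟩
  -- Applying N^(r − l) kills all terms beyond N^l v and leaves c_l N^r v.
  have hlin : ∀ c : ℕ → K, ∑ l ∈ Finset.range (r + 1), c l • (N ^ l) v = 0 →
      ∀ l < r + 1, c l = 0 := by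
    intro c hc l
    induction l using Nat.strong_induction_on with
    | _ l ih =>
      intro hl
      have h1 := congr_arg (N ^ (r - l)) hc
      rw [map_sum, map_zero, Finset.sum_eq_single l] at h1
      · rw [map_smul, ← Module.End.mul_apply, ← pow_add, Nat.sub_add_cancel (by omega)] at h1
        exact (smul_eq_zero.1 h1).resolve_right hv
      · intro k hk hkl
        rcases lt_or_gt_of_ne hkl with h | h
        · rw [ih k h (by omega), zero_smul, map_zero]
        · rw [map_smul, ← Module.End.mul_apply, ← pow_add,
            pow_eq_zero_of_le (by omega : r + 1 ≤ r - l + k) hN0, LinearMap.zero_apply, smul_zero]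
      · intro h; exact absurd (Finset.mem_range.2 hl) h
  have hli : LinearIndependent K fun l : Fin (r + 1) => (N ^ (l : ℕ)) v := by
    rw [Fintype.linearIndependent_iff]
    intro g hg l
    have h := hlin (fun l => if h : l < r + 1 then g ⟨l, h⟩ else 0) ?_ l l.2
    · simpa only [l.2, dif_pos] using h
    · rw [Finset.sum_range, ← hg]
      exact Finset.sum_congr rfl fun l _ => by rw [dif_pos l.2]
  have hcard : Fintype.card (Fin (r + 1)) = Module.finrank K V :=
    le_antisymm hli.fintype_card_le_finrank (by simpa using hr)
  have hspan := hli.span_eq_top_of_card_eq_finrank' hcard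
  intro w hw
  obtain ⟨c, hc⟩ := (Submodule.mem_span_range_iff_exists_fun K).1 (hspan ▸ Submodule.mem_top (x := w))
  set c' : ℕ → K := fun l => if h : l < r + 1 then c ⟨l, h⟩ else 0 with hc'
  have hw' : w = ∑ l ∈ Finset.range (r + 1), c' l • (N ^ l) v := by
    rw [Finset.sum_range, ← hc]
    exact Finset.sum_congr rfl fun l _ => by rw [hc']; simp only [l.2, dif_pos]
  -- N w in terms of the same independent vectors: coefficients move up one place and that of N^r v
  -- is lost. So N w = 0 kills every coefficient of w but the last.
  have h0 : ∑ l ∈ Finset.range (r + 1), (if l = 0 then 0 else c' (l - 1)) • (N ^ l) v = 0 := by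
    rw [Finset.sum_range_succ', if_pos rfl, zero_smul, add_zero]
    rw [hw', Finset.sum_range_succ, map_add, map_sum, map_smul, ← Module.End.mul_apply,
      ← pow_succ', hN0, LinearMap.zero_apply, smul_zero, add_zero] at hw
    rw [← hw]
    refine Finset.sum_congr rfl fun l _ => ?_
    rw [if_neg (by omega), Nat.add_sub_cancel, map_smul, ← Module.End.mul_apply, ← pow_succ']
  have h1 := hlin _ h0
  refine ⟨c' r, ?_⟩
  rw [hw', Finset.sum_range_succ, add_eq_right]
  refine Finset.sum_eq_zero fun l hl => ?_
  have := h1 (l + 1) (by have := Finset.mem_range.1 hl; omega)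
  rw [if_neg (by omega), Nat.add_sub_cancel] at this
  rw [this, zero_smul]

section Operators

variable {K : Type*} [Field K]

theorem mem_degreeLT_of_X_pow {S : Module.End K K[X]} (hS : ∀ m, S (X ^ m) ∈ degreeLT K m)
    {n : ℕ} {f : K[X]} (hf : f ∈ degreeLT K n) : S f ∈ degreeLT K (n - 1) := by
  classical
  rw [degreeLT_eq_span_X_pow] at hf
  induction hf using Submodule.span_induction with
  | mem f hf =>
    simp only [Finset.coe_image, Finset.coe_range, Set.mem_image, Set.mem_Iio] at hf
    obtain ⟨m, hm, rfl⟩ := hf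
    exact degreeLT_mono (by omega) (hS m)
  | zero => simp
  | add f g _ _ hf hg => rw [map_add]; exact add_mem hf hg
  | smul c f _ hf => rw [map_smul]; exact Submodule.smul_mem _ _ hf

theorem pow_mem_degreeLT {S : Module.End K K[X]} (hS : ∀ m, S (X ^ m) ∈ degreeLT K m)
    {n : ℕ} {f : K[X]} (hf : f ∈ degreeLT K n) (i : ℕ) : (S ^ i) f ∈ degreeLT K (n - i) := by
  induction i with
  | zero => simpa using hf
  | succ i ih =>
    rw [pow_succ', Module.End.mul_apply, ← Nat.sub_sub]
    exact mem_degreeLT_of_X_pow hS ih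

theorem mem_degreeLT_zero {f : K[X]} (hf : f ∈ degreeLT K 0) : f = 0 := by
  rw [mem_degreeLT] at hf
  by_contra h
  rw [degree_eq_natDegree h] at hf
  exact absurd hf (by simp)

theorem mem_degreeLT_natDegree (f : K[X]) : f ∈ degreeLT K (f.natDegree + 1) := by
  rw [mem_degreeLT]
  exact degree_le_natDegree.trans_lt (by exact_mod_cast Nat.lt_succ_self _)

theorem mem_degreeLT_two_mul_four_pow (f : K[X]) :
    ∃ i, f ∈ degreeLT K (2 * 4 ^ i + 1) := by
  refine ⟨f.natDegree, degreeLT_mono ?_ (mem_degreeLT_natDegree f)⟩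
  have := Nat.lt_pow_self (n := f.natDegree) (a := 4) (by norm_num)
  omega

theorem operator_apply_eq_sum (S : Module.End K K[X]) (f : K[X]) :
    S f = ∑ m ∈ f.support, f.coeff m • S (X ^ m) := by
  conv_lhs => rw [f.as_sum_support]
  rw [map_sum]
  refine Finset.sum_congr rfl fun m _ => ?_
  rw [← smul_X_eq_monomial, map_smul]

/-- The operator lowers weights by at least one, with leading coefficient one. -/
def IsWeightLowering (S : Module.End K K[X]) : Prop :=
  ∀ m t, (weight m < weight t + 1 → (S (X ^ m)).coeff t = 0) ∧
    (weight m = weight t + 1 → (S (X ^ m)).coeff t = 1)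

/-- A term of f of greatest weight, at m with `evenBits m` nonzero, contributes to S f at the
exponent of weight one less, and no other term reaches that exponent. -/
theorem eq_zero_of_coeff_eq_zero {S : Module.End K K[X]} (htri : IsWeightLowering S)
    {f : K[X]} (hf : S f = 0)
    (h : ∀ m, evenBits m = 0 → f.coeff m = 0) : f = 0 := by
  by_contra hne
  obtain ⟨m, hm, hmax⟩ := f.support.exists_max_image weight (by simpa using hne)
  have hm0 : evenBits m ≠ 0 := fun h0 => (mem_support_iff.1 hm) (h m h0)
  obtain ⟨t, ht1, ht2⟩ := exists_bits_eq (evenBits m - 1) (oddBits m)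
  have hw : weight m = weight t + 1 := by
    rw [weight, weight, ht1, ht2, Nat.cast_sub (by omega)]; push_cast; ring
  have h0 : (S f).coeff t = f.coeff m := by
    rw [operator_apply_eq_sum, finsetSum_coeff, Finset.sum_eq_single m]
    · rw [coeff_smul, (htri m t).2 hw, smul_eq_mul, mul_one]
    · intro k hk hkm
      rw [coeff_smul, (htri k t).1, smul_zero]
      rw [← hw]
      exact lt_of_le_of_ne (hmax k hk) fun h => hkm (weight_injective h)
    · intro h'; exact absurd hm h'
  rw [hf, coeff_zero] at h0
  exact (mem_support_iff.1 hm) h0.symm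

/-- X^n is the leading term of S X^m for the m of weight one more, and the other terms have smaller
weight than n. Only finitely many exponents do, so induction on their number replaces induction on
the real weight. -/
theorem operator_surjective {S : Module.End K K[X]} (htri : IsWeightLowering S) :
    Function.Surjective S := by
  rw [← LinearMap.range_eq_top, eq_top_iff]
  have hfin : ∀ n, {k | weight k < weight n}.Finite := by
    intro n
    have hinj : Set.InjOn (fun k => (evenBits k, oddBits k))
        ((fun k => (evenBits k, oddBits k)) ⁻¹' (Set.Iic ⌊weight n⌋₊ ×ˢ Set.Iic ⌊weight n⌋₊)) := by
      intro a _ b _ hab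
      simp only [Prod.mk.injEq] at hab
      exact eq_of_bits_eq hab.1 hab.2
    refine (((Set.finite_Iic ⌊weight n⌋₊).prod (Set.finite_Iic ⌊weight n⌋₊)).preimage hinj).subset ?_
    intro k hk
    have hs : 1 ≤ √2 := by rw [Real.one_le_sqrt]; norm_num
    have hk' : (evenBits k : ℝ) + √2 * oddBits k < weight n := hk
    have h1 : (0 : ℝ) ≤ evenBits k := by positivity
    have h2 : (0 : ℝ) ≤ oddBits k := by positivity
    have h3 : (oddBits k : ℝ) ≤ √2 * oddBits k := le_mul_of_one_le_left h2 hs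
    exact ⟨Nat.le_floor (by linarith), Nat.le_floor (by linarith)⟩
  have hX : ∀ n, (X ^ n : K[X]) ∈ LinearMap.range S := by
    intro n
    induction hc : {k | weight k < weight n}.ncard using Nat.strong_induction_on generalizing n with
    | _ c ih =>
      obtain ⟨m, hm1, hm2⟩ := exists_bits_eq (evenBits n + 1) (oddBits n)
      have hw : weight m = weight n + 1 := by
        rw [weight, weight, hm1, hm2]; push_cast; ring
      have hsum := (S (X ^ m)).as_sum_support_C_mul_X_pow
      have hn : n ∈ (S (X ^ m)).support := by
        rw [mem_support_iff, (htri m n).2 hw]; exact one_ne_zero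
      rw [← Finset.add_sum_erase _ _ hn, (htri m n).2 hw, map_one, one_mul] at hsum
      have hX' : X ^ n = S (X ^ m) -
          ∑ k ∈ (S (X ^ m)).support.erase n, C ((S (X ^ m)).coeff k) * X ^ k := by
        rw [eq_sub_iff_add_eq]; exact hsum.symm
      rw [hX']
      refine sub_mem (LinearMap.mem_range_self _ _) (Submodule.sum_mem _ fun k hk => ?_)
      rw [← smul_eq_C_mul]
      refine Submodule.smul_mem _ _ ?_
      have hkn : weight k < weight n := by
        obtain ⟨hk1, hk2⟩ := Finset.mem_erase.1 hk
        have : ¬ weight m < weight k + 1 := fun h => (mem_support_iff.1 hk2) ((htri m k).1 h)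
        exact lt_of_le_of_ne (by linarith) fun h => hk1 (weight_injective h)
      refine ih _ ?_ k rfl
      rw [← hc]
      refine Set.ncard_lt_ncard ⟨fun l hl => lt_trans (show weight l < weight k from hl) hkn, ?_⟩
        (hfin n)
      intro hsub
      exact lt_irrefl _ (show weight k < weight k from hsub (show weight k < weight n from hkn))
  intro f _
  rw [f.as_sum_support_C_mul_X_pow]
  refine Submodule.sum_mem _ fun k _ => ?_
  rw [← smul_eq_C_mul]
  exact Submodule.smul_mem _ _ (hX k)

theorem evenBits_lt_two_pow {n i : ℕ} (h : n < 4 ^ i) : evenBits n < 2 ^ i := by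
  induction i generalizing n with
  | zero => simp at h; subst h; simp [evenBits]
  | succ i ih =>
    rw [pow_succ] at h
    have := ih (n := n / 4) (by omega)
    rw [evenBits_eq, pow_succ]
    omega

theorem evenBits_le_two_pow {n i : ℕ} (h : n ≤ 4 ^ i) : evenBits n ≤ 2 ^ i := by
  rcases h.lt_or_eq with h | rfl
  · exact (evenBits_lt_two_pow h).le
  · clear h
    induction i with
    | zero => simp [evenBits]
    | succ i ih =>
      rw [evenBits_eq, pow_succ, Nat.mul_div_cancel _ (by norm_num), pow_succ]
      omega

/-- The polynomials of degree at most `2 * 4^i` killed by the operator. -/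
noncomputable def boundedKer (S : Module.End K K[X]) (i : ℕ) : Submodule K K[X] :=
  LinearMap.ker S ⊓ degreeLT K (2 * 4 ^ i + 1)

theorem finiteDimensional_boundedKer (S : Module.End K K[X]) (i : ℕ) :
    FiniteDimensional K (boundedKer S i) := by
  have : FiniteDimensional K (degreeLT K (2 * 4 ^ i + 1)) :=
    (degreeLTEquiv K (2 * 4 ^ i + 1)).symm.finiteDimensional
  exact Submodule.finiteDimensional_of_le inf_le_right

/-- The exponents m ≤ 2·4^i without digits in even position are indexed by `oddBits m`, which is at
most 2^i, and the coefficients there determine a kernel element. -/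
theorem finrank_boundedKer_le {S : Module.End K K[X]} (htri : IsWeightLowering S) (i : ℕ) :
    Module.finrank K (boundedKer S i) ≤ 2 ^ i + 1 := by
  choose μ hμ1 hμ2 using fun b => exists_bits_eq 0 b
  let φ : boundedKer S i →ₗ[K] (Fin (2 ^ i + 1) → K) :=
    LinearMap.pi fun b => lcoeff K (μ b) ∘ₗ (boundedKer S i).subtype
  have hφ : Function.Injective φ := by
    rw [← LinearMap.ker_eq_bot, LinearMap.ker_eq_bot']
    rintro ⟨f, hf0⟩ hf
    obtain ⟨hf1, hf2⟩ := hf0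
    refine Subtype.ext ?_
    refine eq_zero_of_coeff_eq_zero htri hf1 fun m hm => ?_
    by_cases hmd : m ≤ 2 * 4 ^ i
    · have hb : oddBits m < 2 ^ i + 1 := by
        have := evenBits_le_two_pow (n := m / 2) (i := i) (by omega)
        rw [oddBits]; omega
      have h := congr_fun hf ⟨oddBits m, hb⟩
      have hmm : μ (oddBits m) = m := eq_of_bits_eq (by rw [hμ1, hm]) (hμ2 _)
      simpa [φ, hmm] using h
    · have := mem_degreeLT.1 hf2
      exact coeff_eq_zero_of_degree_lt (this.trans_le (by exact_mod_cast (by omega)))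
  have := LinearMap.finrank_le_finrank_of_injective hφ
  simpa using this

/-- T preserves each `boundedKer S i`, of dimension at most 2^i + 1, and T^(2^i) does not kill
X^(2·4^i) there. So T is a single Jordan block on it, with kernel spanned by a vector of constant
coefficient 1. -/
theorem ker_inf_ker {S T : Module.End K K[X]} (htri : IsWeightLowering S)
    (hT : ∀ m, T (X ^ m) ∈ degreeLT K m) (hST : Commute S T)
    (hS0 : ∀ i, S (X ^ (2 * 4 ^ i)) = 0)
    (hT0 : ∀ i, ((T ^ 2 ^ i) (X ^ (2 * 4 ^ i))).coeff 0 = 1) :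
    (∀ i, (T ^ (2 ^ i + 1)) (X ^ (2 * 4 ^ i)) = 0) ∧
    ∀ f, S f = 0 → T f = 0 → f.coeff 0 = 0 → f = 0 := by
  have key : ∀ i, (T ^ (2 ^ i + 1)) (X ^ (2 * 4 ^ i)) = 0 ∧
      ∀ f ∈ boundedKer S i, T f = 0 → f.coeff 0 = 0 → f = 0 := by
    intro i
    have := finiteDimensional_boundedKer S i
    have hmaps : ∀ f ∈ boundedKer S i, T f ∈ boundedKer S i := by
      rintro f ⟨h1, h2⟩
      refine ⟨?_, degreeLT_mono (by omega) (mem_degreeLT_of_X_pow hT h2)⟩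
      have h3 : S f = 0 := h1
      change S (T f) = 0
      rw [← Module.End.mul_apply, hST.eq, Module.End.mul_apply, h3, map_zero]
    set N : Module.End K (boundedKer S i) := T.restrict hmaps with hN
    have hpow : ∀ n (w : boundedKer S i), (((N ^ n) w : boundedKer S i) : K[X]) = (T ^ n) w := by
      intro n w
      induction n with
      | zero => simp
      | succ n ih =>
        rw [pow_succ', pow_succ', Module.End.mul_apply, Module.End.mul_apply, ← ih]; rfl
    have hnil : IsNilpotent N := by
      refine ⟨2 * 4 ^ i + 1, LinearMap.ext fun w => Subtype.ext ?_⟩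
      rw [hpow]
      have := pow_mem_degreeLT hT w.2.2 (2 * 4 ^ i + 1)
      rw [Nat.sub_self] at this
      simpa using mem_degreeLT_zero this
    have hv : (X ^ (2 * 4 ^ i) : K[X]) ∈ boundedKer S i := by
      refine ⟨hS0 i, ?_⟩
      rw [SetLike.mem_coe, mem_degreeLT, degree_X_pow]
      exact_mod_cast Nat.lt_succ_self _
    have hne : (N ^ 2 ^ i) ⟨_, hv⟩ ≠ 0 := by
      intro h
      have h1 := hpow (2 ^ i) ⟨_, hv⟩
      rw [h] at h1
      have h2 := hT0 i
      rw [← h1] at h2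
      simp at h2
    obtain ⟨h1, h2⟩ := ker_of_nilpotent_of_finrank_le hnil (finrank_boundedKer_le htri i) hne
    constructor
    · have h3 := hpow (2 ^ i + 1) ⟨_, hv⟩
      rw [h1] at h3
      exact h3.symm
    · intro f hf hTf hf0
      obtain ⟨c, hc⟩ := h2 ⟨f, hf⟩ (Subtype.ext hTf)
      have hc' : f = c • (T ^ 2 ^ i) (X ^ (2 * 4 ^ i)) := by
        have := congr_arg Subtype.val hc
        rwa [Submodule.coe_smul, hpow] at this
      rw [hc', coeff_smul, hT0, smul_eq_mul, mul_one] at hf0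
      rw [hc', hf0, zero_smul]
  refine ⟨fun i => (key i).1, fun f hSf => ?_⟩
  obtain ⟨i, hi⟩ := mem_degreeLT_two_mul_four_pow f
  exact (key i).2 f ⟨hSf, hi⟩

theorem exists_last_pow_ne_zero {V : Type*} [AddCommGroup V] [Module K V] (S : Module.End K V)
    {f : V} (hf : f ≠ 0) {n : ℕ} (hn : (S ^ n) f = 0) :
    ∃ a, (S ^ a) f ≠ 0 ∧ S ((S ^ a) f) = 0 := by
  classical
  have hex : ∃ n, (S ^ n) f = 0 := ⟨n, hn⟩
  have h0 : Nat.find hex ≠ 0 := by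
    intro h
    have := Nat.find_spec hex
    rw [h] at this
    exact hf this
  refine ⟨Nat.find hex - 1, Nat.find_min hex (by omega), ?_⟩
  rw [← Module.End.mul_apply, ← pow_succ', Nat.sub_add_cancel (by omega)]
  exact Nat.find_spec hex

/-- A polynomial is determined by the constant coefficients of its images. -/
theorem eq_zero_of_pairing_eq_zero {S T : Module.End K K[X]}
    (hS : ∀ m, S (X ^ m) ∈ degreeLT K m) (hT : ∀ m, T (X ^ m) ∈ degreeLT K m)
    (hST : Commute S T) (hker : ∀ f, S f = 0 → T f = 0 → f.coeff 0 = 0 → f = 0)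
    {f : K[X]} (hf : ∀ i j, ((S ^ i) ((T ^ j) f)).coeff 0 = 0) : f = 0 := by
  have hnil : ∀ {S : Module.End K K[X]}, (∀ m, S (X ^ m) ∈ degreeLT K m) → ∀ f,
      ∃ n, (S ^ n) f = 0 := by
    intro S hS f
    refine ⟨f.natDegree + 1, mem_degreeLT_zero ?_⟩
    simpa using pow_mem_degreeLT hS (mem_degreeLT_natDegree f) (f.natDegree + 1)
  by_contra hne
  -- Applying S, then T, as long as the result is nonzero leads to a nonzero element of ker S ∩ ker
  -- T, whose constant coefficient is one of the vanishing pairings.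
  obtain ⟨n, hn⟩ := hnil hS f
  obtain ⟨a, ha1, ha2⟩ := exists_last_pow_ne_zero S hne hn
  obtain ⟨n, hn⟩ := hnil hT ((S ^ a) f)
  obtain ⟨b, hb1, hb2⟩ := exists_last_pow_ne_zero T ha1 hn
  refine hb1 (hker _ ?_ hb2 ?_)
  · rw [← Module.End.mul_apply, (hST.pow_right b).eq, Module.End.mul_apply, ha2, map_zero]
  · rw [← hf a b, ← Module.End.mul_apply, ← (hST.pow_pow a b).eq, Module.End.mul_apply]

/-- The dual family of the monomials. -/
theorem exists_dual_family {S T : Module.End K K[X]} (htri : IsWeightLowering S)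
    (hT : ∀ m, T (X ^ m) ∈ degreeLT K m) (hST : Commute S T)
    (hS0 : ∀ i, S (X ^ (2 * 4 ^ i)) = 0)
    (hT0 : ∀ i, ((T ^ 2 ^ i) (X ^ (2 * 4 ^ i))).coeff 0 = 1) (a b : ℕ) :
    ∃ f : K[X], ∀ i j, ((S ^ i) ((T ^ j) f)).coeff 0 = if i = a ∧ j = b then 1 else 0 := by
  have hT1 := (ker_inf_ker htri hT hST hS0 hT0).1
  have hzero : ∀ b, ∃ f : K[X], ∀ i j, ((S ^ i) ((T ^ j) f)).coeff 0 =
      if i = 0 ∧ j = b then 1 else 0 := by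
    intro b
    induction b using Nat.strong_induction_on with
    | _ b ih =>
      -- Any i with b ≤ 2^i would serve in X^(2·4^i); here i = b. T^b g ends the chain, so g pairs
      -- to 1 with y^b and to 0 with higher powers of y; the earlier dual vectors correct the lower
      -- ones.
      have hb : b ≤ 2 ^ b := Nat.lt_two_pow_self.le
      set g := (T ^ (2 ^ b - b)) (X ^ (2 * 4 ^ b)) with hg
      have hSg : ∀ i j, i ≠ 0 → (S ^ i) ((T ^ j) g) = 0 := by
        intro i j hi
        obtain ⟨i, rfl⟩ := Nat.exists_eq_succ_of_ne_zero hi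
        rw [hg, ← Module.End.mul_apply (T ^ j), ← pow_add, ← Module.End.mul_apply,
          (hST.pow_pow _ _).eq, Module.End.mul_apply, pow_succ, Module.End.mul_apply, hS0, map_zero,
          map_zero]
      have hTg : ∀ j, b ≤ j → ((T ^ j) g).coeff 0 = if j = b then 1 else 0 := by
        intro j hj
        rw [hg, ← Module.End.mul_apply, ← pow_add]
        split_ifs with h
        · rw [h, Nat.add_sub_cancel' hb, hT0]
        · rw [show j + (2 ^ b - b) = (j - b - 1) + (2 ^ b + 1) by omega, pow_add,
            Module.End.mul_apply, hT1, map_zero, coeff_zero]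
      choose! m hm using ih
      refine ⟨g - ∑ l ∈ Finset.range b, ((T ^ l) g).coeff 0 • m l, fun i j => ?_⟩
      simp only [map_sub, map_sum, map_smul, coeff_sub, finsetSum_coeff, coeff_smul, smul_eq_mul]
      have hsum : ∑ l ∈ Finset.range b, ((T ^ l) g).coeff 0 * ((S ^ i) ((T ^ j) (m l))).coeff 0 =
          ∑ l ∈ Finset.range b, ((T ^ l) g).coeff 0 * if i = 0 ∧ j = l then 1 else 0 :=
        Finset.sum_congr rfl fun l hl => by rw [hm l (Finset.mem_range.1 hl)]
      rw [hsum]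
      by_cases hi : i = 0
      · subst hi
        simp only [true_and, mul_ite, mul_one, mul_zero, Finset.sum_ite_eq, Finset.mem_range,
          pow_zero, Module.End.one_apply]
        split_ifs with h1 h2 h2
        · omega
        · rw [sub_self]
        · rw [sub_zero, hTg j (by omega), if_pos h2]
        · rw [sub_zero, hTg j (by omega), if_neg h2]
      · rw [hSg i j hi]; simp [hi]
  induction a with
  | zero => exact hzero b
  | succ a ih =>
    obtain ⟨f, hf⟩ := ih
    -- A preimage under S has the right pairings for i ≥ 1. The finitely many nonzero ones with i =
    -- 0 are removed by the dual vectors of the case a = 0, which pair to zero when i ≥ 1.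
    obtain ⟨g, rfl⟩ := operator_surjective htri f
    choose m hm using hzero
    have hfin : ∀ j, g.natDegree + 1 ≤ j → (T ^ j) g = 0 := by
      intro j hj
      refine mem_degreeLT_zero ?_
      have := pow_mem_degreeLT hT (mem_degreeLT_natDegree g) j
      rwa [Nat.sub_eq_zero_of_le hj] at this
    refine ⟨g - ∑ l ∈ Finset.range (g.natDegree + 1), ((T ^ l) g).coeff 0 • m l, fun i j => ?_⟩
    simp only [map_sub, map_sum, map_smul, coeff_sub, finsetSum_coeff, coeff_smul, smul_eq_mul, hm]
    rcases i with _ | i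
    · simp only [true_and, mul_ite, mul_one, mul_zero, Finset.sum_ite_eq, Finset.mem_range,
        pow_zero, Module.End.one_apply]
      rw [if_neg (show ¬ (0 = a + 1 ∧ j = b) by omega)]
      split_ifs with h1
      · rw [sub_self]
      · rw [hfin j (by omega), coeff_zero, sub_zero]
    · have h := hf i j
      rw [← Module.End.mul_apply (T ^ j), ← (hST.pow_right j).eq, Module.End.mul_apply,
        ← Module.End.mul_apply (S ^ i), ← pow_succ] at h
      simp [h]

end Operators
end HeckeModTwo

/-! ### The Hecke pairing on 𝓕 and the adapted basis. -/

namespace HeckeModTwo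

theorem heckeT_three_delta_seventh : heckeT 3 (Delta ^ 7) = Delta ^ 5 := by
  have h := heckeT_three_rec 0 (Delta ^ 3)
  have h4 : heckeT 3 (Delta ^ 4) = 0 := by
    rw [show 4 = 2 * 2 by norm_num, pow_mul, heckeT_sq (by decide), heckeT_sq (by decide),
      heckeT_delta (by norm_num) (by norm_num)]
    simp
  rw [heckeT_three_delta_cube] at h
  norm_num [← pow_add, ← pow_succ, ← pow_succ', h4] at h
  exact h

/-- The Hecke operators `T_3` and `T_5` as operators on polynomials in `Δ²`. -/
theorem exists_operators : ∃ S T : Module.End (ZMod 2) (Polynomial (ZMod 2)),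
    (∀ g, oddEval (S g) = heckeT 3 (oddEval g)) ∧ (∀ g, oddEval (T g) = heckeT 5 (oddEval g)) ∧
    (∀ m, S (Polynomial.X ^ m) ∈ Polynomial.degreeLT (ZMod 2) m) ∧
    (∀ m, T (Polynomial.X ^ m) ∈ Polynomial.degreeLT (ZMod 2) m) ∧
    Commute S T ∧ IsWeightLowering S ∧ (∀ i, S (Polynomial.X ^ (2 * 4 ^ i)) = 0) ∧
    ∀ i, ((T ^ 2 ^ i) (Polynomial.X ^ (2 * 4 ^ i))).coeff 0 = 1 := by
  obtain ⟨S, hS1, hS2⟩ := exists_polynomial_operator heckeT_three_pow_mem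
  obtain ⟨T, hT1, hT2⟩ := exists_polynomial_operator heckeT_five_pow_mem
  have hpow : ∀ n g, oddEval ((T ^ n) g) = (heckeT 5 ^ n) (oddEval g) := by
    intro n g
    induction n with
    | zero => simp
    | succ n ih =>
      rw [pow_succ', pow_succ', Module.End.mul_apply, Module.End.mul_apply, hT1, ih]
  have he : ∀ i, 2 * (2 * 4 ^ i) + 1 = 1 + 4 ^ (i + 1) := by intro i; rw [pow_succ]; ring
  refine ⟨S, T, hS1, hT1, hS2, hT2, ?_, ?_, ?_, ?_⟩
  · refine LinearMap.ext fun g => oddEval_injective ?_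
    rw [Module.End.mul_apply, Module.End.mul_apply, hS1, hT1, hT1, hS1, ← Module.End.mul_apply,
      ← Module.End.mul_apply, heckeT_comm (by norm_num) (by norm_num) (by norm_num)]
  · refine coeff_of_recurrence hS2 ?_ ?_ ?_ ?_
    · intro j m
      apply oddEval_injective
      -- X = Δ², so 2^j in an exponent of X is 2^(j+1) in the exponent of Δ.
      have h := heckeT_three_rec (j + 1) (Delta ^ (2 * m + 1))
      rw [map_add, oddEval_X_pow_mul, oddEval_X_pow_mul, hS1, hS1, hS1, oddEval_X_pow,
        oddEval_X_pow, oddEval_X_pow]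
      rw [← pow_add, ← pow_add] at h
      rw [show 2 * (4 * 2 ^ j + m) + 1 = 4 * 2 ^ (j + 1) + (2 * m + 1) by ring,
        show 2 * (2 ^ j + m) + 1 = 2 ^ (j + 1) + (2 * m + 1) by ring,
        show 2 * 2 ^ j = 2 ^ (j + 1) by ring,
        show 2 * (4 * 2 ^ j) = 4 * 2 ^ (j + 1) by ring, h]
    · apply oddEval_injective
      rw [hS1, oddEval_X_pow, heckeT_three_delta_cube, ← pow_zero Polynomial.X, oddEval_X_pow]
      simp
    · apply oddEval_injective
      rw [hS1, oddEval_X_pow, map_zero]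
      exact heckeT_three_delta_pow 1
    · apply oddEval_injective
      rw [hS1, oddEval_X_pow, oddEval_X_pow]
      exact heckeT_three_delta_seventh
  · intro i
    apply oddEval_injective
    rw [hS1, oddEval_X_pow, map_zero, he]
    exact heckeT_three_delta_pow (i + 1)
  · intro i
    rw [← coeff_one_oddEval, hpow, oddEval_X_pow, he]
    exact coeff_one_heckeT_five_delta_pow i

theorem heckeT_mem_F {p : ℕ} (hT : ∀ k, heckeT p (Delta ^ k) ∈ powersBelow k)
    {f : PowerSeries (ZMod 2)} (hf : f ∈ F) : heckeT p f ∈ F := by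
  obtain ⟨S, hS, -⟩ := exists_polynomial_operator hT
  rw [← range_oddEval] at hf ⊢
  obtain ⟨g, rfl⟩ := hf
  exact ⟨S g, hS g⟩

/-- The operator `T_3^i T_5^j`. -/
noncomputable def heckeMonomial (i j : ℕ) : Module.End (ZMod 2) (PowerSeries (ZMod 2)) :=
  heckeT 3 ^ i * heckeT 5 ^ j

theorem heckeMonomial_mem_F (i j : ℕ) {f : PowerSeries (ZMod 2)} (hf : f ∈ F) :
    heckeMonomial i j f ∈ F := by
  have hpow : ∀ {p : ℕ}, (∀ k, heckeT p (Delta ^ k) ∈ powersBelow k) → ∀ (n : ℕ) {f}, f ∈ F →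
      (heckeT p ^ n) f ∈ F := by
    intro p hT n f hf
    induction n with
    | zero => simpa using hf
    | succ n ih => rw [pow_succ', Module.End.mul_apply]; exact heckeT_mem_F hT ih
  exact hpow heckeT_three_pow_mem i (hpow heckeT_five_pow_mem j hf)

theorem heckeMonomial_heckeT_three (i j : ℕ) (f : PowerSeries (ZMod 2)) :
    heckeMonomial i j (heckeT 3 f) = heckeMonomial (i + 1) j f := by
  have hc : Commute (heckeT 3) (heckeT 5) :=
    heckeT_comm (by norm_num) (by norm_num) (by norm_num)
  rw [heckeMonomial, heckeMonomial, ← Module.End.mul_apply, mul_assoc, ← (hc.pow_right j).eq,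
    ← mul_assoc, ← pow_succ]

theorem heckeMonomial_heckeT_five (i j : ℕ) (f : PowerSeries (ZMod 2)) :
    heckeMonomial i j (heckeT 5 f) = heckeMonomial i (j + 1) f := by
  rw [heckeMonomial, heckeMonomial, ← Module.End.mul_apply, mul_assoc, ← pow_succ]

theorem exists_heckeMonomial_eq_zero {f : PowerSeries (ZMod 2)} (hf : f ∈ F) :
    ∃ n, ∀ i j, n ≤ i ∨ n ≤ j → heckeMonomial i j f = 0 := by
  obtain ⟨S, T, hS1, hT1, hS2, hT2, -⟩ := exists_operators
  have hpow : ∀ {p : ℕ} {T : Module.End (ZMod 2) (Polynomial (ZMod 2))},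
      (∀ g, oddEval (T g) = heckeT p (oddEval g)) → ∀ n g,
      (heckeT p ^ n) (oddEval g) = oddEval ((T ^ n) g) := by
    intro p T hT1 n g
    induction n with
    | zero => simp
    | succ n ih =>
      rw [pow_succ', pow_succ', Module.End.mul_apply, Module.End.mul_apply, hT1, ih]
  rw [← range_oddEval] at hf
  obtain ⟨g, rfl⟩ := hf
  refine ⟨g.natDegree + 1, fun i j hij => ?_⟩
  rw [heckeMonomial, Module.End.mul_apply, hpow hT1, hpow hS1,
    mem_degreeLT_zero (f := (S ^ i) ((T ^ j) g)), map_zero]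
  have h := pow_mem_degreeLT hS2 (pow_mem_degreeLT hT2 (mem_degreeLT_natDegree g) j) i
  rwa [show g.natDegree + 1 - j - i = 0 by omega] at h

/-- The pairing of `F` with the monomial `x^i y^j`. -/
noncomputable def heckePairing (i j : ℕ) : Module.Dual (ZMod 2) F :=
  (PowerSeries.coeff (R := ZMod 2) 1) ∘ₗ heckeMonomial i j ∘ₗ F.subtype

theorem heckePairing_apply (i j : ℕ) (f : F) :
    heckePairing i j f = PowerSeries.coeff 1 (heckeMonomial i j f) := rfl

theorem heckePairing_oddEval {S T : Module.End (ZMod 2) (Polynomial (ZMod 2))}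
    (hS : ∀ g, oddEval (S g) = heckeT 3 (oddEval g))
    (hT : ∀ g, oddEval (T g) = heckeT 5 (oddEval g)) (i j : ℕ) (g : Polynomial (ZMod 2)) :
    PowerSeries.coeff 1 (heckeMonomial i j (oddEval g)) = ((S ^ i) ((T ^ j) g)).coeff 0 := by
  rw [← coeff_one_oddEval]
  congr 1
  induction i with
  | zero =>
    induction j with
    | zero => simp [heckeMonomial]
    | succ j ih =>
      simp only [heckeMonomial, pow_zero, one_mul, Module.End.one_apply] at ih ⊢
      rw [pow_succ', pow_succ', Module.End.mul_apply, Module.End.mul_apply, hT, ih]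
  | succ i ih =>
    rw [heckeMonomial, Module.End.mul_apply] at ih ⊢
    rw [pow_succ', pow_succ', Module.End.mul_apply, Module.End.mul_apply, hS, ih]

theorem eq_of_heckePairing_eq {f g : F} (h : ∀ i j, heckePairing i j f = heckePairing i j g) :
    f = g := by
  obtain ⟨S, T, hS1, hT1, hS2, hT2, hST, htri, hS0, hT0⟩ := exists_operators
  rw [← sub_eq_zero]
  obtain ⟨k, hk⟩ : ((f - g : F) : PowerSeries (ZMod 2)) ∈ LinearMap.range oddEval := by
    rw [range_oddEval]; exact (f - g).2
  have hk0 : k = 0 := by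
    refine eq_zero_of_pairing_eq_zero hS2 hT2 hST (ker_inf_ker htri hT2 hST hS0 hT0).2 fun i j => ?_
    rw [← heckePairing_oddEval hS1 hT1, hk, ← heckePairing_apply, map_sub, h, sub_self]
  refine Subtype.ext ?_
  rw [← hk, hk0, map_zero]; rfl

theorem exists_heckePairing_eq (a b : ℕ) :
    ∃ f : F, ∀ i j, heckePairing i j f = if i = a ∧ j = b then 1 else 0 := by
  obtain ⟨S, T, hS1, hT1, hS2, hT2, hST, htri, hS0, hT0⟩ := exists_operators
  obtain ⟨g, hg⟩ := exists_dual_family htri hT2 hST hS0 hT0 a b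
  refine ⟨⟨oddEval g, range_oddEval ▸ LinearMap.mem_range_self _ _⟩, fun i j => ?_⟩
  rw [heckePairing_apply, heckePairing_oddEval hS1 hT1, hg]

/-- The basis dual to the monomials. -/
theorem exists_dual_basis : ∃ m : Module.Basis (ℕ × ℕ) (ZMod 2) F,
    ∀ a b i j, heckePairing i j (m (a, b)) = if i = a ∧ j = b then 1 else 0 := by
  choose v hv using exists_heckePairing_eq
  have hsum : ∀ (s : Finset (ℕ × ℕ)) (g : ℕ × ℕ → ZMod 2) (i j : ℕ),
      heckePairing i j (∑ p ∈ s, g p • v p.1 p.2) = if (i, j) ∈ s then g (i, j) else 0 := by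
    intro s g i j
    have : ∀ p : ℕ × ℕ, (i = p.1 ∧ j = p.2) ↔ (i, j) = p := by
      rintro ⟨a, b⟩; simp
    simp only [map_sum, map_smul, hv, smul_eq_mul, mul_ite, mul_one, mul_zero, this,
      Finset.sum_ite_eq]
  have hli : LinearIndependent (ZMod 2) fun p : ℕ × ℕ => v p.1 p.2 := by
    rw [linearIndependent_iff']
    rintro s g hg ⟨i, j⟩ hp
    have := hsum s g i j
    rw [hg, map_zero, if_pos hp] at this
    exact this.symm
  have hspan : ⊤ ≤ Submodule.span (ZMod 2) (Set.range fun p : ℕ × ℕ => v p.1 p.2) := by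
    intro f _
    obtain ⟨n, hn⟩ := exists_heckeMonomial_eq_zero f.2
    -- The coordinates of f are its pairings, which vanish outside a finite square.
    have : f = ∑ p ∈ Finset.range n ×ˢ Finset.range n, heckePairing p.1 p.2 f • v p.1 p.2 := by
      refine eq_of_heckePairing_eq fun i j => ?_
      rw [hsum _ (fun p => heckePairing p.1 p.2 f)]
      split_ifs with h
      · rfl
      · rw [heckePairing_apply, hn, map_zero]
        simp only [Finset.mem_product, Finset.mem_range] at h
        omega
    rw [this]
    exact Submodule.sum_mem _ fun p _ =>
      Submodule.smul_mem _ _ (Submodule.subset_span ⟨p, rfl⟩)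
  refine ⟨Module.Basis.mk hli hspan, fun a b i j => ?_⟩
  rw [Module.Basis.mk_apply, hv]

/-- T₃ and T₅ step (a, b) down, so each pairing reduces to a_1 of a basis vector or to 0. As
pairings separate 𝓕, this gives uniqueness. -/
theorem heckePairing_of_isAdapted {m : Module.Basis (ℕ × ℕ) (ZMod 2) F} (hm : IsAdapted m)
    (a b i j : ℕ) : heckePairing i j (m (a, b)) = if i = a ∧ j = b then 1 else 0 := by
  rw [heckePairing_apply]
  induction i generalizing a with
  | zero =>
    induction j generalizing b with
    | zero =>
      simp only [heckeMonomial, pow_zero, mul_one, Module.End.one_apply]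
      by_cases h : a = 0 ∧ b = 0
      · obtain ⟨rfl, rfl⟩ := h
        rw [hm.zero_zero, coeff_one_delta, if_pos ⟨rfl, rfl⟩]
      · rw [if_neg (by omega)]
        exact hm.e_eq_zero a b (by omega)
    | succ j ih =>
      rw [← heckeMonomial_heckeT_five]
      rcases b with _ | b
      · rw [hm.T5_zero, map_zero, map_zero, if_neg (by omega)]
      · rw [hm.T5_of_pos _ _ (by omega), Nat.add_sub_cancel, ih]
        simp
  | succ i ih =>
    rw [← heckeMonomial_heckeT_three]
    rcases a with _ | a
    · rw [hm.T3_zero, map_zero, map_zero, if_neg (by omega)]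
    · rw [hm.T3_of_pos _ _ (by omega), Nat.add_sub_cancel, ih]
      simp

/-- T₃ and T₅ shift the pairings by one in i and in j, so both sides of each required identity have
the same pairings and therefore agree. -/
theorem isAdapted_of_heckePairing {m : Module.Basis (ℕ × ℕ) (ZMod 2) F}
    (hm : ∀ a b i j, heckePairing i j (m (a, b)) = if i = a ∧ j = b then 1 else 0) :
    IsAdapted m := by
  have h3 : ∀ (f : F), ∃ g : F, (g : PowerSeries (ZMod 2)) = heckeT 3 f ∧
      ∀ i j, heckePairing i j g = heckePairing (i + 1) j f := fun f =>
    ⟨⟨_, heckeT_mem_F heckeT_three_pow_mem f.2⟩, rfl, fun i j => by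
      rw [heckePairing_apply, heckePairing_apply, ← heckeMonomial_heckeT_three]⟩
  have h5 : ∀ (f : F), ∃ g : F, (g : PowerSeries (ZMod 2)) = heckeT 5 f ∧
      ∀ i j, heckePairing i j g = heckePairing i (j + 1) f := fun f =>
    ⟨⟨_, heckeT_mem_F heckeT_five_pow_mem f.2⟩, rfl, fun i j => by
      rw [heckePairing_apply, heckePairing_apply, ← heckeMonomial_heckeT_five]⟩
  constructor
  · have hD : Delta ∈ F := Submodule.subset_span ⟨0, by simp⟩
    have : m (0, 0) = ⟨Delta, hD⟩ := by
      refine eq_of_heckePairing_eq fun i j => ?_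
      rw [hm, heckePairing_apply]
      rcases i with _ | i
      · rcases j with _ | j
        · simp [heckeMonomial, coeff_one_delta]
        · rw [← heckeMonomial_heckeT_five, heckeT_delta (by norm_num) (by norm_num)]
          simp
      · rw [← heckeMonomial_heckeT_three, heckeT_delta (by norm_num) (by norm_num)]
        simp
    rw [this]
  · intro a b hab
    have := hm a b 0 0
    rw [if_neg (by omega)] at this
    rw [← this, heckePairing_apply]
    simp [heckeMonomial, e]
  · intro a b ha
    obtain ⟨g, hg1, hg2⟩ := h3 (m (a, b))
    rw [← hg1]
    congr 1
    refine eq_of_heckePairing_eq fun i j => ?_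
    rw [hg2, hm, hm]
    congr 1
    exact propext (by omega)
  · intro b
    obtain ⟨g, hg1, hg2⟩ := h3 (m (0, b))
    rw [← hg1]
    have : g = 0 := by
      refine eq_of_heckePairing_eq fun i j => ?_
      rw [hg2, hm, map_zero, if_neg (by omega)]
    rw [this]; rfl
  · intro a b hb
    obtain ⟨g, hg1, hg2⟩ := h5 (m (a, b))
    rw [← hg1]
    congr 1
    refine eq_of_heckePairing_eq fun i j => ?_
    rw [hg2, hm, hm]
    congr 1
    exact propext (by omega)
  · intro a
    obtain ⟨g, hg1, hg2⟩ := h5 (m (a, 0))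
    rw [← hg1]
    have : g = 0 := by
      refine eq_of_heckePairing_eq fun i j => ?_
      rw [hg2, hm, map_zero, if_neg (by omega)]
    rw [this]; rfl

theorem finite_monomialAct_ne_zero (f : F) :
    {d : Fin 2 →₀ ℕ | monomialAct d (f : PowerSeries (ZMod 2)) ≠ 0}.Finite := by
  obtain ⟨n, hn⟩ := exists_heckeMonomial_eq_zero f.2
  have hinj : Set.InjOn (fun d : Fin 2 →₀ ℕ => (d 0, d 1))
      ((fun d : Fin 2 →₀ ℕ => (d 0, d 1)) ⁻¹' (Set.Iio n ×ˢ Set.Iio n)) := by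
    intro d _ d' _ h
    simp only [Prod.mk.injEq] at h
    ext i
    fin_cases i
    · exact h.1
    · exact h.2
  refine (((Set.finite_Iio n).prod (Set.finite_Iio n)).preimage hinj).subset ?_
  intro d hd
  simp only [Set.mem_preimage, Set.mem_prod, Set.mem_Iio]
  by_contra h
  exact hd (hn (d 0) (d 1) (by omega))

end HeckeModTwo

theorem mainTheorem6 :
    (∃! m : Module.Basis (ℕ × ℕ) (ZMod 2) HeckeModTwo.F, HeckeModTwo.IsAdapted m) ∧
    (∀ f : HeckeModTwo.F,
      {d : Fin 2 →₀ ℕ |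
        HeckeModTwo.monomialAct d (f : PowerSeries (ZMod 2)) ≠ 0}.Finite) ∧
    (∀ m : Module.Basis (ℕ × ℕ) (ZMod 2) HeckeModTwo.F, HeckeModTwo.IsAdapted m →
      ∀ (a b : ℕ) (u : MvPowerSeries (Fin 2) (ZMod 2)),
        ∃ g : HeckeModTwo.F,
          (g : PowerSeries (ZMod 2)) = HeckeModTwo.seriesAct u (m (a, b)) ∧
          HeckeModTwo.e g =
            MvPowerSeries.coeff (Finsupp.single 0 a + Finsupp.single 1 b) u) := by
  refine ⟨?_, HeckeModTwo.finite_monomialAct_ne_zero, ?_⟩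
  · obtain ⟨m, hm⟩ := HeckeModTwo.exists_dual_basis
    refine ⟨m, HeckeModTwo.isAdapted_of_heckePairing hm, fun m' hm' => ?_⟩
    refine Module.Basis.eq_of_apply_eq fun p => ?_
    obtain ⟨a, b⟩ := p
    refine HeckeModTwo.eq_of_heckePairing_eq fun i j => ?_
    rw [hm, HeckeModTwo.heckePairing_of_isAdapted hm']
  · intro m hm a b u
    have hfin := HeckeModTwo.finite_monomialAct_ne_zero (m (a, b))
    have hact : HeckeModTwo.seriesAct u (m (a, b)) = ∑ d ∈ hfin.toFinset,
        MvPowerSeries.coeff d u • HeckeModTwo.monomialAct d (m (a, b)) := by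
      refine finsum_eq_sum_of_support_subset _ fun d hd => ?_
      rw [Set.Finite.coe_toFinset]
      intro h
      rw [Function.mem_support, h, smul_zero] at hd
      exact hd rfl
    have hmem : HeckeModTwo.seriesAct u (m (a, b)) ∈ HeckeModTwo.F := by
      rw [hact]
      exact Submodule.sum_mem _ fun d _ => Submodule.smul_mem _ _
        (HeckeModTwo.heckeMonomial_mem_F (d 0) (d 1) (m (a, b)).2)
    refine ⟨⟨_, hmem⟩, rfl, ?_⟩
    have hcoeff : ∀ d : Fin 2 →₀ ℕ,
        PowerSeries.coeff 1 (HeckeModTwo.monomialAct d (m (a, b))) =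
          if d 0 = a ∧ d 1 = b then 1 else 0 := fun d =>
      HeckeModTwo.heckePairing_of_isAdapted hm a b (d 0) (d 1)
    change PowerSeries.coeff 1 (HeckeModTwo.seriesAct u (m (a, b))) = _
    rw [hact, map_sum, Finset.sum_eq_single (Finsupp.single 0 a + Finsupp.single 1 b)]
    · rw [map_smul, hcoeff, if_pos (by simp), smul_eq_mul, mul_one]
    · intro d _ hd
      rw [map_smul, hcoeff, if_neg, smul_zero]
      rintro ⟨h1, h2⟩
      apply hd
      ext i
      fin_cases i
      · simpa using h1
      · simpa using h2
    · intro h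
      rw [Set.Finite.mem_toFinset, Set.mem_ofPred_eq, not_not] at h
      rw [h, smul_zero, map_zero]
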